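/- Let $q$ be a prime power, $n\ge 1$ and $k\ge 3$ integers, and let $I=\{i_0,i_1,\dots,i_{k-1}\}$ with $0=i_0<i_1<\cdots<i_{k-1}$ integers. Put $$F_I(X_1,\dots,X_k)=\det\bigl(X_r^{q^{i_{c}}}\bigr)_{1\le r\le k,\;0\le c\le k-1},\qquad G_k(X_1,\dots,X_k)=\det\bigl(X_r^{q^{c}}\bigr)_{1\le r\le k,\;0\le c\le k-1},$$ and let $\mathcal V_I$ be the hypersurface with equation $F_I/G_k=0$, where $G_k\neq 0$ and $F_I/G_k$ is a polynomial. Suppose that $i_2=2i_1$, that $I$ is not an arithmetic progression, and that one of the following holds: (1) $q\ge 7$; (2) $q\in\{3,4,5\}$ and $i_1>1$; (3) $q=2$ and $i_1>2$. Then $\mathcal V_I$ contains a non-repeated $\mathbb F_{q^n}$-rational absolutely irreducible component; that is, there is a polynomial $W\in\mathbb F_{q^n}[X_1,\dots,X_k]$, irreducible over every algebraic extension of $\mathbb F_{q^n}$, such that $W$ divides $F_I/G_k$ and $W^2$ does not. -/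

import Mathlib

universe u

/-- The determinant of the `k × k` matrix with entry `X_r ^ (q ^ (e c))` in row `r` and column `c`.
For `e = i` (the increasing enumeration of `I`) this is the polynomial `F_I`; for `e = (0, 1, …, k-1)`
it is the Moore determinant `G_k`. -/
noncomputable def mooreDet (K : Type u) [Field K] (q : ℕ) {k : ℕ} (e : Fin k → ℕ) :
    MvPolynomial (Fin k) K :=
  (Matrix.of fun r c : Fin k => (MvPolynomial.X r : MvPolynomial (Fin k) K) ^ q ^ e c).det

/-- `H` is the polynomial `F_I / G_k`, that is, `H` is a defining polynomial of the hypersurface `V_I`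
over `K`. Since `G_k ≠ 0` in a domain, there is at most one such `H`. -/
def IsMooreQuotient (K : Type u) [Field K] (q : ℕ) {k : ℕ} (i : Fin k → ℕ)
    (H : MvPolynomial (Fin k) K) : Prop :=
  mooreDet K q (fun c : Fin k => (c : ℕ)) ≠ 0 ∧
    mooreDet K q i = mooreDet K q (fun c : Fin k => (c : ℕ)) * H

/-- A polynomial over `K` is absolutely irreducible if it is irreducible over every algebraic
extension of `K`. (The algebraic closure of `K` lives in the same universe as `K`.) -/
def IsAbsolutelyIrreducible {K : Type u} [Field K] {σ : Type*} (W : MvPolynomial σ K) : Prop :=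
  ∀ (L : Type u) [Field L] [Algebra K L] [Algebra.IsAlgebraic K L],
    Irreducible (MvPolynomial.map (algebraMap K L) W)

/-- The hypersurface `H = 0` over `K` has `W = 0` as a non-repeated `K`-rational absolutely
irreducible component: `W` has coefficients in `K`, is absolutely irreducible, and divides `H`
exactly once. -/
def IsNonrepeatedRationalAbsIrredComponent {K : Type u} [Field K] {σ : Type*}
    (W H : MvPolynomial σ K) : Prop :=
  IsAbsolutelyIrreducible W ∧ W ∣ H ∧ ¬ W ^ 2 ∣ H

/-- The terms `e 0, e 1, …, e (k-1)` form an arithmetic progression. -/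
def IsArithmeticProgression {k : ℕ} (e : Fin k → ℕ) : Prop :=
  ∃ a d : ℕ, ∀ j : Fin k, e j = a + (j : ℕ) * d

/-! Write F for the Moore determinant with exponents I and G for the one with exponents 0, …, k-1.
Over an algebraic closure it suffices to find an irreducible factor of F that does not divide G and
is associated to its Frobenius conjugate (`HasStableFactor`): scaled to have a coefficient 1, it is
defined over the finite field, and it divides F/G. Multiplicity one is automatic, since ∂F/∂X_r is
up to sign a minor free of X_r, which makes F squarefree (`not_mul_self_dvd_frobDet`).

The factor comes from induction on the number of variables. Let θ be the leading or the constant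
coefficient in X_0, and let a stable irreducible A' divide the image of F. If A' cannot divide the
images of two factors of F at once, the irreducible factor that carries A' is unique, hence stable
(`hasStableFactor_of_monoidHom`).

The leading coefficient of F is up to sign the determinant without the largest exponent, so that
exponent can be dropped as long as the others are not in progression
(`hasStableFactor_frobDet_succ`). As i_2 = 2 i_1, this stops at exponents 0, d, 2d, … followed by
some E that breaks the progression. If d ∤ E, a linear form dividing the leading coefficient forces
an irreducible factor of at least half the degree, too large to have a second conjugate
(`hasStableFactor_of_not_dvd`). If d ∣ E, replacing q by q^d leaves consecutive exponents and a gap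
before the last. There the constant coefficient of F/X_0 is the q-th power of the determinant in one
variable fewer, and a Newton polygon edge with coprime ends offsets the multiplicity q
(`hasStableFactor_gapExp_succ`).

What remains is three variables with exponents 0, 1, m + 2, m ≠ 0, where F/G is irreducible
(`irreducible_of_frobDet_gapExp_two_eq_mul`): two factors would meet in the projective plane at a
singular point of F = 0, such points are rational over the field with q^(m+1) elements, and local
Newton edges with coprime ends forbid both factors to vanish there. -/

/-! ### Newton polygon edges and factors singled out by a prime -/

open Polynomial in
theorem exists_first_argmin (f : ℕ → ℕ∞) :
    ∃ i₀, (∀ i, f i₀ ≤ f i) ∧ ∀ i < i₀, f i₀ < f i := by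
  classical
  have hne : ∃ i, ∀ j, f i ≤ f j := by
    obtain ⟨m, ⟨i, rfl⟩, hm⟩ := WellFounded.has_min (wellFounded_lt (α := ℕ∞)) (Set.range f)
      ⟨f 0, 0, rfl⟩
    exact ⟨i, fun j => not_lt.mp (hm _ ⟨j, rfl⟩)⟩
  refine ⟨Nat.find hne, Nat.find_spec hne, fun i hi => ?_⟩
  have h := Nat.find_min hne hi
  push Not at h
  obtain ⟨j, hj⟩ := h
  exact (Nat.find_spec hne j).trans_lt hj

open Polynomial in
/-- If the Newton polygon of `A * B` at a prime `π` starts with an edge from `(0, m)` to `(n, 0)`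
and `m`, `n` are coprime, then the edge belongs to one of the factors. -/
theorem not_dvd_coeff_zero_of_newton_edge {R : Type*} [CommRing R] [IsDomain R] {π : R}
    (hπ : Prime π) {m n : ℕ} (hn : 0 < n) (hmn : n.Coprime m) (A B : R[X])
    (hend : ¬ π ∣ (A * B).coeff n) (hstart : ¬ π ^ (m + 1) ∣ (A * B).coeff 0)
    (habove : ∀ i v, n * v + m * i < m * n → π ^ (v + 1) ∣ (A * B).coeff i) :
    ¬ (π ∣ A.coeff 0 ∧ π ∣ B.coeff 0) := by
  classical
  rintro ⟨hA0, hB0⟩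
  obtain ⟨⟨α, β⟩, hαβ, hterm⟩ : ∃ x ∈ Finset.HasAntidiagonal.antidiagonal n,
      ¬ π ∣ A.coeff x.1 * B.coeff x.2 := by
    by_contra! h
    exact hend (by rw [coeff_mul]; exact Finset.dvd_sum h)
  rw [Finset.HasAntidiagonal.mem_antidiagonal] at hαβ
  simp only at hαβ hterm
  have hα : ¬ π ∣ A.coeff α := fun h => hterm (h.mul_right _)
  have hβ : ¬ π ∣ B.coeff β := fun h => hterm (h.mul_left _)
  set v : R → ℕ∞ := emultiplicity π with hv
  have vmul : ∀ x y, v (x * y) = v x + v y := fun x y => emultiplicity_mul hπ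
  have vle : ∀ (x : R) (k : ℕ), π ^ k ∣ x ↔ (k : ℕ∞) ≤ v x := fun x k =>
    pow_dvd_iff_le_emultiplicity
  have vzero : ∀ x, ¬ π ∣ x → v x = 0 := fun x hx => emultiplicity_eq_zero.mpr hx
  -- Minimise the weight n·v + m·i over the Newton points of each factor. Taking first minimisers
  -- leaves a single term of least valuation in the coefficient of index i₀ + j₀, so nothing
  -- cancels.
  obtain ⟨i₀, hi₀, hi₀'⟩ := exists_first_argmin fun i => n * v (A.coeff i) + m * i
  obtain ⟨j₀, hj₀, hj₀'⟩ := exists_first_argmin fun j => n * v (B.coeff j) + m * j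
  have hA1 := hi₀ α
  have hB1 := hj₀ β
  have hA2 := hi₀ 0
  have hB2 := hj₀ 0
  simp only [vzero _ hα, vzero _ hβ, mul_zero, zero_add, Nat.cast_zero, add_zero] at hA1 hB1 hA2 hB2
  have fin_of : ∀ (x : ℕ∞) (c d : ℕ), (n : ℕ∞) * x + c ≤ d → ∃ k : ℕ, x = k := by
    intro x c d h
    have : x ≠ ⊤ := by
      rintro rfl
      rw [ENat.mul_top (by exact_mod_cast hn.ne')] at h
      simp at h
    exact ⟨x.toNat, (ENat.natCast_toNat this).symm⟩
  obtain ⟨k, hk⟩ := fin_of (v (A.coeff i₀)) (m * i₀) (m * α) (by exact_mod_cast hA1)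
  obtain ⟨l, hl⟩ := fin_of (v (B.coeff j₀)) (m * j₀) (m * β) (by exact_mod_cast hB1)
  have hnot : ¬ π ^ (k + l + 1) ∣ (A * B).coeff (i₀ + j₀) := by
    rw [coeff_mul, ← Finset.add_sum_erase _ _
      (show (i₀, j₀) ∈ Finset.HasAntidiagonal.antidiagonal (i₀ + j₀) by simp)]
    rw [dvd_add_left]
    · rw [vle, vmul, hk, hl]
      norm_cast
      omega
    · refine Finset.dvd_sum ?_
      rintro ⟨i, j⟩ hij
      rw [Finset.mem_erase, Finset.HasAntidiagonal.mem_antidiagonal] at hij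
      obtain ⟨hne, hsum⟩ := hij
      simp only at hsum
      rw [vle, vmul]
      have hlt : (n : ℕ∞) * (k + l : ℕ) + (m * (i₀ + j₀) : ℕ) <
          n * (v (A.coeff i) + v (B.coeff j)) + (m * (i₀ + j₀) : ℕ) := by
        have e1 : (n : ℕ∞) * (k + l : ℕ) + (m * (i₀ + j₀) : ℕ) =
            (n * v (A.coeff i₀) + m * i₀) + (n * v (B.coeff j₀) + m * j₀) := by
          rw [hk, hl]; push_cast; ring
        have e2 : n * (v (A.coeff i) + v (B.coeff j)) + (m * (i₀ + j₀) : ℕ) =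
            (n * v (A.coeff i) + m * i) + (n * v (B.coeff j) + m * j) := by
          rw [← hsum]; push_cast; ring
        rw [e1, e2]
        have f1 : (n : ℕ∞) * v (A.coeff i₀) + m * i₀ ≠ ⊤ := by
          rw [hk]; exact_mod_cast ENat.natCast_ne_top (n * k + m * i₀)
        have f2 : (n : ℕ∞) * v (B.coeff j₀) + m * j₀ ≠ ⊤ := by
          rw [hl]; exact_mod_cast ENat.natCast_ne_top (n * l + m * j₀)
        rcases lt_trichotomy i i₀ with h | h | h
        · exact ENat.add_lt_add_of_lt_of_le f2 (hi₀' i h) (hj₀ j)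
        · exact absurd (Prod.ext h (by simp only; omega)) hne
        · exact ENat.add_lt_add_of_le_of_lt f1 (hi₀ i) (hj₀' j (by omega))
      have : ((k + l : ℕ) : ℕ∞) < v (A.coeff i) + v (B.coeff j) := by
        by_contra! h
        exact absurd hlt (not_lt.mpr (by gcongr))
      exact_mod_cast Order.add_one_le_of_lt this
  have hge : m * n ≤ n * (k + l) + m * (i₀ + j₀) := by
    by_contra! h
    exact hnot (habove _ _ h)
  have h0 : ¬ ((m + 1 : ℕ) : ℕ∞) ≤ v (A.coeff 0) + v (B.coeff 0) := by
    rw [← vmul, ← vle, ← mul_coeff_zero]; exact hstart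
  obtain ⟨a, ha⟩ : ∃ a : ℕ, v (A.coeff 0) = a := by
    refine ⟨_, (ENat.natCast_toNat fun h => h0 ?_).symm⟩
    simp [h]
  obtain ⟨b, hb⟩ : ∃ b : ℕ, v (B.coeff 0) = b := by
    refine ⟨_, (ENat.natCast_toNat fun h => h0 ?_).symm⟩
    simp [h]
  have ha1 : 1 ≤ a := by
    have := (vle (A.coeff 0) 1).mp (by simpa using hA0)
    rw [ha] at this
    exact_mod_cast this
  have hb1 : 1 ≤ b := by
    have := (vle (B.coeff 0) 1).mp (by simpa using hB0)
    rw [hb] at this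
    exact_mod_cast this
  rw [hk, ha] at hA2
  rw [hl, hb] at hB2
  rw [hk] at hA1
  rw [hl] at hB1
  rw [ha, hb] at h0
  norm_cast at hA1 hB1 hA2 hB2 h0
  -- The two minima add up to at least m * n, but are bounded by m * α and m * β with α + β = n, and
  -- by n * a and n * b with a + b ≤ m. So all these bounds are equalities.
  have e1 : n * a = m * α := by nlinarith
  have hdvd : n ∣ α := hmn.dvd_of_dvd_mul_left ⟨a, e1.symm⟩
  rcases Nat.eq_zero_or_pos α with h | h
  · subst h; exact hα hA0
  · have : α = n := le_antisymm (by omega) (Nat.le_of_dvd h hdvd)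
    have : β = 0 := by omega
    subst this; exact hβ hB0

/-- Only multiplicativity of θ is needed, which allows θ to be the leading coefficient. -/
theorem exists_irreducible_dvd_of_prime_dvd_map {S R : Type*} [CommRing S] [IsDomain S]
    [WfDvdMonoid S] [CommRing R] (θ : S →* R) {π : R} (hπ : Prime π) {F : S} (hF : F ≠ 0)
    (h : π ∣ θ F) : ∃ A, Irreducible A ∧ A ∣ F ∧ π ∣ θ A := by
  obtain ⟨f, hf, u, hu⟩ := WfDvdMonoid.exists_factors F hF
  have h1 : π ∣ θ f.prod := by
    rw [← hu, map_mul] at h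
    exact ((u.isUnit.map θ).dvd_mul_right).mp h
  rw [map_multiset_prod] at h1
  obtain ⟨A, hA, hπA⟩ := hπ.exists_mem_multiset_map_dvd h1
  exact ⟨A, hf A hA, (Multiset.dvd_prod hA).trans (Dvd.intro _ hu), hπA⟩

theorem associated_of_not_mul_dvd {S : Type*} [CommRing S] [IsDomain S] [DecompositionMonoid S]
    {A B F : S} (hA : Irreducible A) (hB : Irreducible B) (hAF : A ∣ F) (hBF : B ∣ F)
    (h : ¬ A * B ∣ F) : Associated A B := by
  by_contra hne
  apply h
  obtain ⟨C, rfl⟩ := hAF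
  refine mul_dvd_mul_left A ?_
  refine (hB.prime.dvd_or_dvd hBF).resolve_left fun h' => hne ?_
  exact (hB.associated_of_dvd hA h').symm

/-! ### Descent to a finite field -/

theorem mem_range_algebraMap_of_pow_card_eq {K L : Type*} [Field K] [Finite K] [Field L]
    [Algebra K L] {x : L} (hx : x ^ Nat.card K = x) : x ∈ Set.range (algebraMap K L) := by
  have := Fintype.ofFinite K
  rw [Nat.card_eq_fintype_card] at hx
  have hs : (Polynomial.X ^ Fintype.card K - Polynomial.X : Polynomial K).Splits := by
    rw [Polynomial.splits_iff_card_roots, FiniteField.roots_X_pow_card_sub_X,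
      FiniteField.X_pow_card_sub_X_natDegree_eq _ Fintype.one_lt_card]
    rfl
  have hne : (Polynomial.X ^ Fintype.card K - Polynomial.X : Polynomial L) ≠ 0 :=
    FiniteField.X_pow_card_sub_X_ne_zero L Fintype.one_lt_card
  have hroot : x ∈ (Polynomial.X ^ Fintype.card K - Polynomial.X : Polynomial L).roots := by
    rw [Polynomial.mem_roots hne]
    simp [hx]
  have hmap : ((Polynomial.X ^ Fintype.card K - Polynomial.X : Polynomial K).map
      (algebraMap K L)) = Polynomial.X ^ Fintype.card K - Polynomial.X := by simp
  rw [← hmap, hs.roots_map, Multiset.mem_map] at hroot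
  obtain ⟨a, -, ha⟩ := hroot
  exact ⟨a, ha⟩

namespace MvPolynomial

variable {σ : Type*}

theorem exists_map_eq_of_frobenius_fixed {K L : Type*} [Field K] [Fintype K] [Field L]
    [Algebra K L] [Algebra.IsAlgebraic K L] {A : MvPolynomial σ L}
    (h : map (FiniteField.frobeniusAlgEquivOfAlgebraic K L : L →+* L) A = A) :
    ∃ W : MvPolynomial σ K, map (algebraMap K L) W = A := by
  refine mem_range_map_iff_coeffs_subset.mpr fun x hx => ?_
  obtain ⟨m, -, rfl⟩ := mem_coeffs_iff.mp hx
  refine mem_range_algebraMap_of_pow_card_eq ?_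
  have := congrArg (coeff m) h
  rw [coeff_map] at this
  rw [Nat.card_eq_fintype_card]
  exact this

/-- By cancellation the quotient over L is fixed by Frobenius, hence has coefficients in K. -/
theorem map_dvd_map_iff_of_field {K L : Type*} [Field K] [Fintype K] [Field L]
    [Algebra K L] [Algebra.IsAlgebraic K L] {W H : MvPolynomial σ K} (hW : W ≠ 0)
    (h : map (algebraMap K L) W ∣ map (algebraMap K L) H) : W ∣ H := by
  obtain ⟨S, hS⟩ := h
  have hinj := map_injective (σ := σ) _ (algebraMap K L).injective
  have hfix : ∀ P : MvPolynomial σ K,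
      map (FiniteField.frobeniusAlgEquivOfAlgebraic K L : L →+* L) (map (algebraMap K L) P) =
        map (algebraMap K L) P := by
    intro P
    rw [map_map]
    refine congrArg (fun f => map f P) (RingHom.ext fun x => ?_)
    simp
  obtain ⟨S', rfl⟩ := exists_map_eq_of_frobenius_fixed (K := K) (A := S) (by
    have h1 := congrArg (map (FiniteField.frobeniusAlgEquivOfAlgebraic K L : L →+* L)) hS
    rw [map_mul, hfix, hfix, hS] at h1
    exact (mul_left_cancel₀ ((map_ne_zero_iff _ hinj).mpr hW) h1).symm)
  rw [← map_mul] at hS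
  exact ⟨S', hinj hS⟩

/-- An irreducible factor over an algebraic extension of a finite field that is associated to its
Frobenius conjugate is defined over the finite field. -/
theorem exists_map_associated_of_frobenius_stable {K L : Type*} [Field K] [Fintype K] [Field L]
    [Algebra K L] [Algebra.IsAlgebraic K L] {A : MvPolynomial σ L} (hA : A ≠ 0)
    (h : Associated (map (FiniteField.frobeniusAlgEquivOfAlgebraic K L : L →+* L) A) A) :
    ∃ W : MvPolynomial σ K, Associated (map (algebraMap K L) W) A := by
  -- Once a coefficient is scaled to 1 it stays 1 under Frobenius, so the unit relating the two
  -- conjugates is 1.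
  obtain ⟨m, hm⟩ := ne_zero_iff.mp hA
  set c := A.coeff m
  have hu : IsUnit (C c⁻¹ : MvPolynomial σ L) := (isUnit_iff_ne_zero.mpr (inv_ne_zero hm)).map C
  have hassoc : Associated (C c⁻¹ * A) A := by
    rw [mul_comm]
    exact associated_mul_unit_left A _ hu
  set φ := (FiniteField.frobeniusAlgEquivOfAlgebraic K L : L →+* L)
  have hassoc' : Associated (map φ (C c⁻¹ * A)) (C c⁻¹ * A) := by
    refine (hassoc.map (map φ)).trans (h.trans hassoc.symm)
  obtain ⟨u, hu⟩ := hassoc'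
  obtain ⟨d, hd, hdu⟩ := MvPolynomial.isUnit_iff_eq_C_of_isReduced.mp u.isUnit
  rw [hdu] at hu
  have h1 := congrArg (coeff m) hu
  rw [mul_comm, coeff_C_mul, coeff_map, coeff_C_mul, inv_mul_cancel₀ hm, map_one, mul_one] at h1
  rw [h1, C_1, mul_one] at hu
  obtain ⟨W, hW⟩ := exists_map_eq_of_frobenius_fixed hu
  exact ⟨W, hW ▸ hassoc⟩

theorem irreducible_of_irreducible_map {K L : Type*} [Field K] [Field L] (f : K →+* L)
    {W : MvPolynomial σ K} (h : Irreducible (map f W)) : Irreducible W := by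
  classical
  have : IsLocalHom (map f : MvPolynomial σ K →+* MvPolynomial σ L) := by
    refine ⟨fun P hP => ?_⟩
    obtain ⟨d, hd, hP⟩ := MvPolynomial.isUnit_iff_eq_C_of_isReduced.mp hP
    have h1 : P = C (P.coeff 0) := by
      ext m
      apply f.injective
      rw [← coeff_map, hP, coeff_C, coeff_C]
      have := congrArg (coeff 0) hP
      rw [coeff_map, coeff_C, if_pos rfl] at this
      split_ifs
      · exact this.symm
      · rw [map_zero]
    rw [h1]
    refine IsUnit.map C (isUnit_iff_ne_zero.mpr fun h0 => ?_)
    rw [h1, h0, C_0, map_zero] at hP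
    exact hd.ne_zero (C_injective _ _ (by rw [← hP, C_0]))
  exact h.of_map

end MvPolynomial

/-! ### Homogeneous factors and intersections in the plane -/

namespace MvPolynomial

variable {σ : Type*}

/-- Substituting T * X_i for X_i turns homogeneous components into coefficients in T. The product
becomes a monomial in T; since degree and trailing degree both add, they coincide for each factor.
-/
theorem isHomogeneous_of_mul {R : Type*} [CommRing R] [IsDomain R] {A B : MvPolynomial σ R}
    {N : ℕ} (h : (A * B).IsHomogeneous N) (h0 : A * B ≠ 0) : ∃ n, A.IsHomogeneous n := by
  classical
  set ψ : MvPolynomial σ R →ₐ[R] Polynomial (MvPolynomial σ R) :=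
    aeval fun i => Polynomial.X * Polynomial.C (X i)
  have hψ : ∀ (P : MvPolynomial σ R) (n : ℕ) (m : σ →₀ ℕ),
      coeff m ((ψ P).coeff n) = if m.degree = n then coeff m P else 0 := by
    intro P n m
    induction P using MvPolynomial.induction_on' with
    | monomial d a =>
      have h1 : ψ (monomial d a) = Polynomial.C (monomial d a) * Polynomial.X ^ d.degree := by
        rw [aeval_monomial]
        simp only [mul_pow, Finsupp.prod_mul]
        rw [monomial_eq, map_mul, Finsupp.degree_apply]
        simp only [Finsupp.prod, map_prod, map_pow, Finset.prod_pow_eq_pow_sum]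
        rw [mul_assoc, mul_comm (Polynomial.X ^ _)]
        rfl
      rw [h1, Polynomial.coeff_C_mul_X_pow]
      by_cases hdm : d = m
      · subst hdm
        split_ifs <;> first | rfl | omega
      · split_ifs <;> simp [coeff_monomial, hdm]
    | add P Q hP hQ =>
      rw [map_add, Polynomial.coeff_add, coeff_add, hP, hQ, coeff_add]
      split_ifs <;> simp
  have hne : ∀ P : MvPolynomial σ R, P ≠ 0 → ψ P ≠ 0 := by
    intro P hP h
    obtain ⟨m, hm⟩ := ne_zero_iff.mp hP
    have := hψ P m.degree m
    rw [h, if_pos rfl] at this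
    exact hm (by simpa using this.symm)
  obtain ⟨hA, hB⟩ := mul_ne_zero_iff.mp h0
  have hmono : ψ A * ψ B = Polynomial.monomial N (A * B) := by
    rw [← map_mul]
    ext n m
    rw [hψ, Polynomial.coeff_monomial]
    split_ifs with h1 h2 h2
    · rfl
    · by_contra h3
      exact h2 ((h h3 ▸ (by rw [← h1, Finsupp.degree_eq_weight_one]; rfl)))
    · by_contra h3
      refine h1 ?_
      have := h (Ne.symm h3)
      rw [← h2, ← this, Finsupp.degree_eq_weight_one]; rfl
    · rfl
  have hdeg := Polynomial.natDegree_mul (hne A hA) (hne B hB)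
  have htdeg := Polynomial.natTrailingDegree_mul (hne A hA) (hne B hB)
  rw [hmono, Polynomial.natDegree_monomial_eq _ h0] at hdeg
  rw [hmono, Polynomial.natTrailingDegree_monomial h0] at htdeg
  have h1 := Polynomial.natTrailingDegree_le_natDegree (ψ A)
  have h2 := Polynomial.natTrailingDegree_le_natDegree (ψ B)
  refine ⟨(ψ A).natDegree, fun m hm => ?_⟩
  have h3 : (ψ A).coeff m.degree ≠ 0 := by
    intro h4
    have := hψ A m.degree m
    rw [h4, if_pos rfl] at this
    exact hm (by simpa using this.symm)
  have h4 := Polynomial.le_natDegree_of_ne_zero h3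
  have h5 := Polynomial.natTrailingDegree_le_of_ne_zero h3
  have h6 : m.degree = (ψ A).natDegree := by omega
  rw [← h6, Finsupp.degree_eq_weight_one]; rfl

/-- Two polynomials in three variables without constant term have a common zero besides the
origin. -/
theorem exists_common_zero {L : Type*} [Field L] [IsAlgClosed L] (A B : MvPolynomial (Fin 3) L)
    (hA : eval 0 A = 0) (hB : eval 0 B = 0) : ∃ P : Fin 3 → L, P ≠ 0 ∧ eval P A = 0 ∧ eval P B = 0 := by
  -- If the origin were the only common zero, the Nullstellensatz would make its ideal minimal over
  -- two generators, of height at most 2 by Krull. The chain of ideals `p 0 < p 1 < p 2 < p 3` of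
  -- coordinate subspaces gives height 3.
  by_contra! hno
  set I : Ideal (MvPolynomial (Fin 3) L) := Ideal.span {A, B}
  let f : ℕ → (MvPolynomial (Fin 3) L →ₐ[L] MvPolynomial (Fin 3) L) := fun n =>
    aeval fun i => if (i : ℕ) < n then 0 else X i
  set p : ℕ → Ideal (MvPolynomial (Fin 3) L) := fun n => RingHom.ker (f n)
  have hp : ∀ n, (p n).IsPrime := fun n => RingHom.ker_isPrime _
  have hle : ∀ n : Fin 3, p n < p (n + 1) := by
    intro n
    refine lt_of_le_of_ne ?_ fun h => ?_
    · intro P hP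
      have hc : (f (n + 1)).comp (f n) = f (n + 1) := by
        ext i
        simp only [f, AlgHom.comp_apply, aeval_X]
        by_cases h1 : (i : ℕ) < n
        · simp [h1, Nat.lt_succ_of_lt h1]
        · simp [h1]
      rw [RingHom.mem_ker] at hP ⊢
      have := congrArg (fun g => g P) hc
      simp only [AlgHom.comp_apply] at this
      rw [← this]
      erw [hP]
      simp
    · have h1 : X n ∈ p (n + 1) := by
        rw [RingHom.mem_ker]; simp [f]
      rw [← h, RingHom.mem_ker] at h1
      simp [f] at h1
  have hstep : ∀ n : Fin 3, (p n).height + 1 ≤ (p (n + 1)).height := fun n =>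
    have := hp n
    have := hp (n + 1)
    Ideal.height_add_one_le_of_lt_of_isPrime (hle n)
  have h3 : (3 : ℕ∞) ≤ (p 3).height := by
    have e0 := hstep 0
    have e1 := hstep 1
    have e2 := hstep 2
    simp only [Fin.val_zero, Fin.val_one, Fin.val_two, zero_add] at e0 e1 e2
    calc (3 : ℕ∞) = 0 + 1 + 1 + 1 := by norm_num
      _ ≤ (p 0).height + 1 + 1 + 1 := by gcongr; exact zero_le
      _ ≤ (p 1).height + 1 + 1 := by gcongr
      _ ≤ (p 2).height + 1 := by gcongr
      _ ≤ (p 3).height := e2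
  have hmem : ∀ P, P ∈ p 3 ↔ eval 0 P = 0 := by
    intro P
    have : f 3 = (Algebra.ofId L _).comp (aeval (0 : Fin 3 → L)) := by
      ext i : 1
      simp [f]
    rw [RingHom.mem_ker, this, AlgHom.comp_apply, Algebra.ofId_apply,
      map_eq_zero_iff _ (FaithfulSMul.algebraMap_injective _ _)]
    rfl
  have hmin : p 3 ∈ I.minimalPrimes := by
    refine ⟨⟨hp 3, ?_⟩, ?_⟩
    · rw [Ideal.span_le]
      rintro P (rfl | rfl)
      · exact (hmem _).mpr hA
      · exact (hmem _).mpr hB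
    · rintro J ⟨hJ, hIJ⟩ -
      refine le_trans ?_ (hJ.radical_le_iff.mpr hIJ)
      rw [← vanishingIdeal_zeroLocus_eq_radical (K := L)]
      intro P hP Q hQ
      have hQ0 : Q = 0 := by
        by_contra hne
        refine hno Q hne ?_ ?_
        · exact hQ A (Ideal.subset_span (by simp))
        · exact hQ B (Ideal.subset_span (by simp))
      rw [hQ0]
      exact (hmem P).mp hP
  have h2 := Ideal.height_le_card_of_mem_minimalPrimes_span (Set.toFinite _) hmin
  have h4 : ({A, B} : Set (MvPolynomial (Fin 3) L)).ncard ≤ 2 :=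
    (Set.ncard_insert_le _ _).trans (by simp)
  have h5 : (3 : ℕ∞) ≤ 2 := h3.trans (h2.trans (by exact_mod_cast h4))
  exact absurd h5 (by decide)

end MvPolynomial

/-- Every algebraic extension embeds in the algebraic closure, and irreducibility descends along
field embeddings. -/
theorem isAbsolutelyIrreducible_of_algebraicClosure {K : Type u} [Field K] {σ : Type*}
    {W : MvPolynomial σ K}
    (h : Irreducible (MvPolynomial.map (algebraMap K (AlgebraicClosure K)) W)) :
    IsAbsolutelyIrreducible W := by
  intro L _ _ _
  refine MvPolynomial.irreducible_of_irreducible_map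
    (IsAlgClosed.lift (M := AlgebraicClosure K) : L →ₐ[K] AlgebraicClosure K).toRingHom ?_
  rw [MvPolynomial.map_map]
  convert h
  exact (IsAlgClosed.lift (M := AlgebraicClosure K) : L →ₐ[K] AlgebraicClosure K).comp_algebraMap

/-! ### Moore determinants over a ring of characteristic p -/

/-- The determinant of the `k × k` matrix with entry `x r ^ q ^ e c` in row `r` and column `c`. -/
def frobDet {R : Type*} [CommRing R] (q : ℕ) {k : ℕ} (x : Fin k → R) (e : Fin k → ℕ) : R :=
  (Matrix.of fun r c : Fin k => x r ^ q ^ e c).det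

section frobDet

variable {R S : Type*} [CommRing R] [CommRing S]

theorem map_frobDet (f : R →+* S) (q : ℕ) {k : ℕ} (x : Fin k → R) (e : Fin k → ℕ) :
    f (frobDet q x e) = frobDet q (fun r => f (x r)) e := by
  rw [frobDet, frobDet, RingHom.map_det]
  congr 1
  ext r c
  simp

theorem frobDet_mul_left (q d : ℕ) {k : ℕ} (x : Fin k → R) (e : Fin k → ℕ) :
    frobDet q x (fun c => d * e c) = frobDet (q ^ d) x e := by
  simp only [frobDet, pow_mul]

theorem frobDet_succ (q : ℕ) {k : ℕ} (x : Fin (k + 1) → R) (e : Fin (k + 1) → ℕ)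
    (r : Fin (k + 1)) :
    frobDet q x e = ∑ c : Fin (k + 1), (-1) ^ (r + c : ℕ) * x r ^ q ^ e c *
      frobDet q (fun j => x (r.succAbove j)) (fun j => e (c.succAbove j)) :=
  Matrix.det_succ_row _ r

variable (p s : ℕ) [Fact p.Prime] [CharP R p]

theorem frobDet_add (j : ℕ) {k : ℕ} (x : Fin k → R) (e : Fin k → ℕ) :
    frobDet (p ^ s) x (fun c => e c + j) = frobDet (p ^ s) x e ^ (p ^ s) ^ j := by
  have h : ∀ a : R, a ^ (p ^ s) ^ j = iterateFrobenius R p (s * j) a := by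
    intro a; rw [iterateFrobenius_def, pow_mul]
  rw [h, map_frobDet]
  simp only [frobDet, ← h]
  congr 1
  ext r c
  simp only [Matrix.of_apply, ← pow_mul, pow_add, mul_comm]

/-- If the q-polynomial N kills the first k entries, then N^q - N(x_last)^(q-1) N kills the last one
too. This needs no division, so it works over any commutative ring of characteristic p. -/
theorem exists_pow_eq_sum {k : ℕ} (x : Fin k → R) : ∃ n : ℕ → R, ∀ r,
    x r ^ (p ^ s) ^ k = ∑ j ∈ Finset.range k, n j * x r ^ (p ^ s) ^ j := by
  induction k with
  | zero => exact ⟨0, fun r => r.elim0⟩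
  | succ k ih =>
    obtain ⟨n, hn⟩ := ih fun r => x r.castSucc
    set N : R → R := fun t => t ^ (p ^ s) ^ k - ∑ j ∈ Finset.range k, n j * t ^ (p ^ s) ^ j with hN
    set c : R := N (x (Fin.last k)) ^ (p ^ s - 1) with hc
    refine ⟨fun j => (if j = 0 then 0 else n (j - 1) ^ p ^ s) + if j = k then c else -(c * n j),
      fun r => ?_⟩
    have hfrob : N (x r) ^ p ^ s = x r ^ (p ^ s) ^ (k + 1) -
        ∑ j ∈ Finset.range k, n j ^ p ^ s * x r ^ (p ^ s) ^ (j + 1) := by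
      rw [hN, sub_pow_char_pow, sum_pow_char_pow, ← pow_mul, ← pow_succ]
      congr 1
      refine Finset.sum_congr rfl fun j _ => ?_
      rw [mul_pow, ← pow_mul, ← pow_succ]
    have hzero : N (x r) ^ p ^ s - c * N (x r) = 0 := by
      refine Fin.lastCases ?_ (fun i => ?_) r
      · rw [hc, ← pow_succ, Nat.sub_add_cancel (Nat.pos_of_ne_zero
          (pow_ne_zero s (Fact.out : p.Prime).ne_zero)), sub_self]
      · have : N (x i.castSucc) = 0 := by rw [hN]; simp only; rw [hn, sub_self]
        rw [this, zero_pow (pow_ne_zero s (Fact.out : p.Prime).ne_zero)]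
        ring
    simp only [add_mul, Finset.sum_add_distrib]
    rw [Finset.sum_range_succ', Finset.sum_range_succ (f := fun j => (if j = k then c else _) * _)]
    have h1 : ∑ j ∈ Finset.range k, (if j = k then c else -(c * n j)) * x r ^ (p ^ s) ^ j =
        -(c * ∑ j ∈ Finset.range k, n j * x r ^ (p ^ s) ^ j) := by
      rw [Finset.mul_sum, ← Finset.sum_neg_distrib]
      refine Finset.sum_congr rfl fun j hj => ?_
      rw [if_neg (Finset.mem_range.mp hj).ne]
      ring
    rw [h1, if_pos rfl]
    rw [hfrob, hN] at hzero
    simp only [Nat.add_eq_zero_iff, one_ne_zero, and_false, if_false, if_true, Nat.add_sub_cancel,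
      zero_mul, add_zero]
    linear_combination hzero

theorem exists_pow_eq_sum_fin {k : ℕ} (x : Fin k → R) (t : ℕ) : ∃ α : Fin k → R, ∀ r,
    x r ^ (p ^ s) ^ t = ∑ j, α j * x r ^ (p ^ s) ^ (j : ℕ) := by
  suffices h : ∃ α : ℕ → R, ∀ r,
      x r ^ (p ^ s) ^ t = ∑ j ∈ Finset.range k, α j * x r ^ (p ^ s) ^ j by
    obtain ⟨α, hα⟩ := h
    exact ⟨fun j => α j, fun r => by
      rw [hα, Finset.sum_range fun j => α j * x r ^ (p ^ s) ^ j]⟩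
  obtain _ | k := k
  · exact ⟨0, fun r => r.elim0⟩
  induction t with
  | zero => exact ⟨fun j => if j = 0 then 1 else 0, fun r => by simp⟩
  | succ t ih =>
    obtain ⟨α, hα⟩ := ih
    obtain ⟨n, hn⟩ := exists_pow_eq_sum p s x
    refine ⟨fun j => (if j = 0 then 0 else α (j - 1) ^ p ^ s) + α k ^ p ^ s * n j, fun r => ?_⟩
    have h1 : x r ^ (p ^ s) ^ (t + 1) =
        ∑ j ∈ Finset.range (k + 1), α j ^ p ^ s * x r ^ (p ^ s) ^ (j + 1) := by
      rw [pow_succ, pow_mul, hα, sum_pow_char_pow]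
      refine Finset.sum_congr rfl fun j _ => ?_
      rw [mul_pow, ← pow_mul, ← pow_succ]
    rw [h1, Finset.sum_range_succ, hn]
    simp only [add_mul, Finset.sum_add_distrib]
    rw [Finset.sum_range_succ' (fun j => (if j = 0 then 0 else α (j - 1) ^ p ^ s) * _) k]
    simp only [mul_assoc, ← Finset.mul_sum, Nat.add_eq_zero_iff, one_ne_zero, and_false, if_false,
      if_true, Nat.add_sub_cancel, zero_mul, add_zero]

/-- Every column is a combination of the columns with exponents 0, …, k-1, so the matrix is a
product. -/
theorem frobDet_dvd {k : ℕ} (x : Fin k → R) (e : Fin k → ℕ) :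
    frobDet (p ^ s) x (fun c => (c : ℕ)) ∣ frobDet (p ^ s) x e := by
  choose α hα using exists_pow_eq_sum_fin p s x
  refine ⟨(Matrix.of fun j c => α (e c) j).det, ?_⟩
  rw [frobDet, frobDet, ← Matrix.det_mul]
  congr 1
  ext r c
  rw [Matrix.mul_apply, Matrix.of_apply, hα]
  refine Finset.sum_congr rfl fun j _ => ?_
  simp [mul_comm]

end frobDet

/-! ### Expansion in the first variable, derivatives and squarefreeness -/

open Polynomial in
/-- The polynomial `∑ a c * T ^ f c`. -/
noncomputable def sparsePoly {R : Type*} [CommRing R] {k : ℕ} (a : Fin k → R) (f : Fin k → ℕ) : R[X] :=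
  ∑ c, C (a c) * X ^ f c

section sparsePoly

variable {R : Type*} [CommRing R] {k : ℕ}

theorem coeff_sparsePoly (a : Fin k → R) {f : Fin k → ℕ} (hf : Function.Injective f) (c : Fin k) :
    (sparsePoly a f).coeff (f c) = a c := by
  rw [sparsePoly, Polynomial.finsetSum_coeff, Finset.sum_eq_single c]
  · simp
  · intro b _ hb
    rw [Polynomial.coeff_C_mul_X_pow, if_neg fun h => hb (hf h.symm)]
  · simp

theorem coeff_sparsePoly_of_ne (a : Fin k → R) {f : Fin k → ℕ} {n : ℕ} (h : ∀ c, f c ≠ n) :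
    (sparsePoly a f).coeff n = 0 := by
  rw [sparsePoly, Polynomial.finsetSum_coeff]
  refine Finset.sum_eq_zero fun c _ => ?_
  rw [Polynomial.coeff_C_mul_X_pow, if_neg (h c).symm]

theorem natDegree_sparsePoly (a : Fin (k + 1) → R) {f : Fin (k + 1) → ℕ} (hf : StrictMono f)
    (h : a (Fin.last k) ≠ 0) : (sparsePoly a f).natDegree = f (Fin.last k) := by
  refine Polynomial.natDegree_eq_of_le_of_coeff_ne_zero ?_
    (by rwa [coeff_sparsePoly a hf.injective])
  rw [Polynomial.natDegree_le_iff_coeff_eq_zero]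
  intro n hn
  exact coeff_sparsePoly_of_ne a fun c => ((hf.monotone (Fin.le_last c)).trans_lt hn).ne

theorem leadingCoeff_sparsePoly (a : Fin (k + 1) → R) {f : Fin (k + 1) → ℕ} (hf : StrictMono f)
    (h : a (Fin.last k) ≠ 0) : (sparsePoly a f).leadingCoeff = a (Fin.last k) := by
  rw [Polynomial.leadingCoeff, natDegree_sparsePoly a hf h, coeff_sparsePoly a hf.injective]

theorem X_mul_sparsePoly (a : Fin k → R) {f : Fin k → ℕ} (hf : ∀ c, 0 < f c) :
    Polynomial.X * sparsePoly a (fun c => f c - 1) = sparsePoly a f := by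
  rw [sparsePoly, sparsePoly, Finset.mul_sum]
  refine Finset.sum_congr rfl fun c _ => ?_
  obtain ⟨n, hn⟩ := Nat.exists_eq_succ_of_ne_zero (hf c).ne'
  rw [hn, Nat.succ_sub_one, pow_succ]
  ring

end sparsePoly

/-- The coefficients of a Moore determinant as a polynomial in its first variable. -/
def frobCoeff {R : Type*} [CommRing R] (q : ℕ) {k : ℕ} (x : Fin k → R) (e : Fin (k + 1) → ℕ)
    (c : Fin (k + 1)) : R :=
  (-1) ^ (c : ℕ) * frobDet q x (fun j => e (c.succAbove j))

theorem frobDet_cons {R : Type*} [CommRing R] (q : ℕ) {k : ℕ} (t : R) (x : Fin k → R)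
    (e : Fin (k + 1) → ℕ) :
    frobDet q (Fin.cons t x : Fin (k + 1) → R) e =
      (sparsePoly (frobCoeff q x e) (fun c => q ^ e c)).eval t := by
  rw [frobDet_succ q _ e 0, sparsePoly, Polynomial.eval_finsetSum]
  refine Finset.sum_congr rfl fun c _ => ?_
  simp [frobCoeff]
  ring

namespace MvPolynomial

variable (L : Type*) [Field L] (q : ℕ)

theorem finSuccEquiv_frobDet {k : ℕ} (e : Fin (k + 1) → ℕ) :
    finSuccEquiv L k (frobDet q X e) = sparsePoly (frobCoeff q X e) (fun c => q ^ e c) := by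
  have h := map_frobDet (finSuccEquiv L k : MvPolynomial (Fin (k + 1)) L →+*
    Polynomial (MvPolynomial (Fin k) L)) q X e
  refine h.trans ?_
  rw [frobDet_succ q _ e 0, sparsePoly]
  refine Finset.sum_congr rfl fun c _ => ?_
  have h2 := map_frobDet (Polynomial.C : MvPolynomial (Fin k) L →+*
    Polynomial (MvPolynomial (Fin k) L)) q X
    (fun j => e (c.succAbove j))
  simp only [frobCoeff, RingHom.coe_coe, finSuccEquiv_X_zero, Fin.zero_succAbove,
    finSuccEquiv_X_succ, map_mul, map_pow, map_neg, map_one, Fin.val_zero, zero_add, h2]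
  ring

theorem frobDet_X_ne_zero (hq : 1 < q) {k : ℕ} {e : Fin k → ℕ} (he : StrictMono e) :
    frobDet q (X : Fin k → MvPolynomial (Fin k) L) e ≠ 0 := by
  induction k with
  | zero => simp [frobDet]
  | succ k ih =>
    intro h
    have h1 := finSuccEquiv_frobDet L q e
    rw [h, map_zero] at h1
    have h2 := coeff_sparsePoly (frobCoeff q (X : Fin k → MvPolynomial (Fin k) L) e)
      (((pow_right_strictMono₀ hq).comp he).injective) (Fin.last k)
    simp only [Function.comp_def] at h2
    rw [← h1, Polynomial.coeff_zero, frobCoeff] at h2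
    have h3 := ih (e := fun j => e ((Fin.last k).succAbove j))
      (he.comp (Fin.strictMono_succAbove _))
    exact mul_ne_zero (pow_ne_zero _ (neg_ne_zero.mpr one_ne_zero)) h3 h2.symm

variable {q}

theorem frobDet_rename {k n : ℕ} (f : Fin k → Fin n) (e : Fin k → ℕ) :
    frobDet q (fun j => X (f j)) e = rename f (frobDet q (X : Fin k → MvPolynomial _ L) e) := by
  refine Eq.trans ?_ (map_frobDet (rename f : MvPolynomial (Fin k) L →ₐ[L] _).toRingHom q X e).symm
  simp

theorem degreeOf_rename_of_notMem_range {σ τ R : Type*} [CommRing R] {f : σ → τ}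
    (hf : Function.Injective f) {i : τ} (hi : i ∉ Set.range f) (P : MvPolynomial σ R) :
    degreeOf i (rename f P) = 0 := by
  classical
  refine Nat.le_zero.mp (degreeOf_le_iff.mpr fun m hm => ?_)
  rw [support_rename_of_injective hf, Finset.mem_image] at hm
  obtain ⟨m', -, rfl⟩ := hm
  rw [Finsupp.mapDomain_of_notMem_range _ _ hi]

theorem frobDet_succAbove_ne_zero (hq : 1 < q) {k : ℕ} {e : Fin k → ℕ} (he : StrictMono e)
    (r : Fin (k + 1)) :
    frobDet q (fun j => (X (r.succAbove j) : MvPolynomial (Fin (k + 1)) L)) e ≠ 0 := by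
  rw [frobDet_rename, map_ne_zero_iff _ (rename_injective _ Fin.succAbove_right_injective)]
  exact frobDet_X_ne_zero L q hq he

/-- An irreducible polynomial does not divide all the partial derivatives of a Moore determinant
with smallest exponent `0`. -/
theorem exists_not_dvd_frobDet_succAbove {k : ℕ} (hq : 1 < q) {e : Fin (k + 1) → ℕ}
    (he : StrictMono e) {W : MvPolynomial (Fin (k + 1)) L} (hW : Irreducible W) :
    ∃ r : Fin (k + 1), ¬ W ∣ frobDet q (fun j => X (r.succAbove j)) (fun j => e j.succ) := by
  obtain ⟨r, hr⟩ : ∃ r, 0 < degreeOf r W := by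
    by_contra! h
    have h0 : W.totalDegree = 0 := (totalDegree_eq_zero_iff _ _).mpr fun m hm x =>
      Nat.le_zero.mp ((monomial_le_degreeOf x hm).trans (h x))
    rw [totalDegree_eq_zero_iff_eq_C] at h0
    refine hW.not_isUnit ?_
    rw [h0]
    refine IsUnit.map C (isUnit_iff_ne_zero.mpr fun h1 => hW.ne_zero ?_)
    rw [h0, h1, C_0]
  refine ⟨r, fun ⟨S, hS⟩ => ?_⟩
  have hne := frobDet_succAbove_ne_zero L hq (he.comp (Fin.strictMono_succ)) r
  simp only [Function.comp_def] at hne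
  have h0 : degreeOf r (frobDet q (fun j => (X (r.succAbove j) : MvPolynomial (Fin (k + 1)) L))
      (fun j => e j.succ)) = 0 := by
    rw [frobDet_rename]
    exact degreeOf_rename_of_notMem_range Fin.succAbove_right_injective (by simp) _
  rw [hS] at hne h0
  rw [degreeOf_mul_eq (left_ne_zero_of_mul hne) (right_ne_zero_of_mul hne)] at h0
  omega

/-- Powers with exponent q^j, j > 0, have derivative zero because q = 0 in L, so only the column
with exponent 0 contributes. -/
theorem pderiv_frobDet (hq : (q : L) = 0) {k : ℕ} {e : Fin (k + 1) → ℕ} (he : StrictMono e)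
    (he0 : e 0 = 0) (r : Fin (k + 1)) :
    pderiv r (frobDet q (X : Fin (k + 1) → MvPolynomial _ L) e) =
      (-1) ^ (r : ℕ) * frobDet q (fun j => X (r.succAbove j)) (fun j => e j.succ) := by
  have hminor : ∀ e' : Fin k → ℕ, pderiv r (frobDet q
      (fun j => (X (r.succAbove j) : MvPolynomial (Fin (k + 1)) L)) e') = 0 := by
    intro e'
    refine pderiv_eq_zero_of_notMem_vars fun h => ?_
    rw [frobDet_rename] at h
    obtain ⟨j, -, hj⟩ := mem_vars_rename _ _ h
    exact Fin.succAbove_ne r j hj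
  have hsign : ∀ n : ℕ, pderiv r ((-1) ^ n : MvPolynomial (Fin (k + 1)) L) = 0 := by
    intro n
    have : ((-1) ^ n : MvPolynomial (Fin (k + 1)) L) = C ((-1) ^ n) := by simp
    rw [this, pderiv_C]
  rw [frobDet_succ q _ e r, map_sum, Finset.sum_eq_single 0]
  · rw [(pderiv r).leibniz, (pderiv r).leibniz, hminor, hsign, he0]
    simp
    ring
  · intro c _ hc
    have hec : 0 < e c := he0 ▸ he (Fin.pos_of_ne_zero hc)
    have hq' : ((q ^ e c : ℕ) : MvPolynomial (Fin (k + 1)) L) = 0 := by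
      rw [← map_natCast C, Nat.cast_pow, hq, zero_pow hec.ne', C_0]
    rw [(pderiv r).leibniz, (pderiv r).leibniz, hminor, hsign, (pderiv r).leibniz_pow]
    rw [← Nat.cast_smul_eq_nsmul (MvPolynomial (Fin (k + 1)) L), hq']
    simp
  · simp

/-- W would divide every partial derivative, and one of these is a nonzero minor free of a variable
occurring in W. -/
theorem not_mul_self_dvd_frobDet (hq1 : 1 < q) (hq : (q : L) = 0) {k : ℕ} {e : Fin (k + 1) → ℕ}
    (he : StrictMono e) (he0 : e 0 = 0) {W : MvPolynomial (Fin (k + 1)) L} (hW : Irreducible W) :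
    ¬ W * W ∣ frobDet q X e := by
  rintro ⟨S, hS⟩
  obtain ⟨r, hr⟩ := exists_not_dvd_frobDet_succAbove L hq1 he hW
  apply hr
  have h := pderiv_frobDet L hq he he0 r
  rw [hS, (pderiv r).leibniz, (pderiv r).leibniz] at h
  have hu : IsUnit ((-1 : MvPolynomial (Fin (k + 1)) L) ^ (r : ℕ)) := isUnit_one.neg.pow _
  rw [← hu.dvd_mul_left, ← h]
  exact ⟨W * pderiv r S + S * pderiv r W + S * pderiv r W, by simp only [smul_eq_mul]; ring⟩

end MvPolynomial

/-! ### Stable factors, and removal of the largest exponent -/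

namespace MvPolynomial

theorem finSuccEquiv_map_eq {R S : Type*} [CommRing R] [CommRing S] (φ : R →+* S) {k : ℕ}
    (A : MvPolynomial (Fin (k + 1)) R) :
    finSuccEquiv S k (map φ A) = (finSuccEquiv R k A).map (map φ) := by
  induction A using MvPolynomial.induction_on with
  | C a => simp [finSuccEquiv_apply]
  | add P Q hP hQ => simp [hP, hQ]
  | mul_X P i hP =>
    rw [map_mul, map_mul, map_mul, Polynomial.map_mul, hP, map_X]
    congr 1
    refine Fin.cases ?_ (fun j => ?_) i
    · simp [finSuccEquiv_X_zero]
    · simp [finSuccEquiv_X_succ]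

variable {L : Type*} [Field L] (φ : L ≃+* L)

/-- `F` has an irreducible factor that does not divide `M` and is stable under `φ`. -/
def HasStableFactor {σ : Type*} (M F : MvPolynomial σ L) : Prop :=
  ∃ A, Irreducible A ∧ A ∣ F ∧ ¬ A ∣ M ∧ Associated (map (φ : L →+* L) A) A

variable {φ}

theorem irreducible_map_ringEquiv {σ : Type*} {A : MvPolynomial σ L} (hA : Irreducible A) :
    Irreducible (map (φ : L →+* L) A) :=
  (MulEquiv.irreducible_iff (mapEquiv σ φ)).mpr hA

/-- If A' divides θ A, it also divides θ (φ A), because θ commutes with φ and A' is stable. Were A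
and φ A not associated, their product would divide F, against `hsimple`. -/
theorem hasStableFactor_of_monoidHom {σ τ : Type*}
    (θ : MvPolynomial σ L →* MvPolynomial τ L)
    (hθ : ∀ A, θ (map (φ : L →+* L) A) = map (φ : L →+* L) (θ A))
    {A' : MvPolynomial τ L} (hA' : Irreducible A') (hφ : Associated (map (φ : L →+* L) A') A')
    {M F : MvPolynomial σ L} (hF : F ≠ 0) (hφF : map (φ : L →+* L) F = F)
    (hdvd : A' ∣ θ F) (hM : ¬ A' ∣ θ M)
    (hsimple : ∀ A B, A * B ∣ F → ¬ (A' ∣ θ A ∧ A' ∣ θ B)) : HasStableFactor φ M F := by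
  obtain ⟨A, hA, hAF, hAA'⟩ := exists_irreducible_dvd_of_prime_dvd_map θ hA'.prime hF hdvd
  refine ⟨A, hA, hAF, fun h => hM (hAA'.trans (map_dvd θ h)), ?_⟩
  refine associated_of_not_mul_dvd (irreducible_map_ringEquiv hA) hA
    (hφF ▸ map_dvd (map (φ : L →+* L)) hAF) hAF fun h => hsimple _ _ h ⟨?_, hAA'⟩
  rw [hθ]
  exact hφ.symm.dvd.trans (map_dvd _ hAA')

theorem map_frobDet_X (q : ℕ) {k : ℕ} (e : Fin k → ℕ) :
    map (φ : L →+* L) (frobDet q X e) = frobDet q X e := by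
  rw [map_frobDet]
  simp

theorem leadingCoeff_finSuccEquiv_frobDet {q : ℕ} (hq : 1 < q) {k : ℕ} {e : Fin (k + 1) → ℕ}
    (he : StrictMono e) :
    (finSuccEquiv L k (frobDet q X e)).leadingCoeff =
      (-1) ^ k * frobDet q X (fun j => e j.castSucc) := by
  rw [finSuccEquiv_frobDet, leadingCoeff_sparsePoly]
  · simp [frobCoeff]
  · exact (pow_right_strictMono₀ hq).comp he
  · refine mul_ne_zero (pow_ne_zero _ (neg_ne_zero.mpr one_ne_zero)) ?_
    exact frobDet_X_ne_zero L q hq (he.comp (Fin.strictMono_succAbove _))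

theorem dvd_neg_one_pow_mul {R : Type*} [CommRing R] {a b : R} (n : ℕ) :
    a ∣ (-1) ^ n * b ↔ a ∣ b :=
  (isUnit_one.neg.pow n).dvd_mul_left

theorem hasStableFactor_frobDet_succ {q : ℕ} (hq1 : 1 < q) (hq : (q : L) = 0) {k : ℕ}
    {e : Fin (k + 2) → ℕ} (he : StrictMono e) (he0 : e 0 = 0)
    (h : HasStableFactor φ (frobDet q X (fun c : Fin (k + 1) => (c : ℕ)))
      (frobDet q X (fun j : Fin (k + 1) => e j.castSucc))) :
    HasStableFactor φ (frobDet q X (fun c : Fin (k + 2) => (c : ℕ))) (frobDet q X e) := by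
  obtain ⟨A', hA', hdvd, hM, hφ⟩ := h
  refine hasStableFactor_of_monoidHom (Polynomial.leadingCoeffHom.comp
    (finSuccEquiv L (k + 1) : _ →* Polynomial (MvPolynomial (Fin (k + 1)) L))) ?_ hA' hφ
    (frobDet_X_ne_zero L q hq1 he) (map_frobDet_X q e) ?_ ?_ ?_
  · intro A
    change (finSuccEquiv L (k + 1) (map (φ : L →+* L) A)).leadingCoeff = _
    rw [finSuccEquiv_map_eq, Polynomial.leadingCoeff_map_of_injective
      (map_injective _ (φ : L →+* L).injective)]
    rfl
  · change _ ∣ (finSuccEquiv L (k + 1) _).leadingCoeff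
    rwa [leadingCoeff_finSuccEquiv_frobDet hq1 he, dvd_neg_one_pow_mul]
  · change ¬ _ ∣ (finSuccEquiv L (k + 1) _).leadingCoeff
    rwa [leadingCoeff_finSuccEquiv_frobDet hq1 Fin.val_strictMono, dvd_neg_one_pow_mul]
  · rintro A B hAB ⟨hA, hB⟩
    refine not_mul_self_dvd_frobDet L hq1 hq (he.comp Fin.strictMono_castSucc) he0 hA' ?_
    refine (mul_dvd_mul hA hB).trans ?_
    rw [← map_mul]
    refine (map_dvd _ hAB).trans ?_
    change (finSuccEquiv L (k + 1) _).leadingCoeff ∣ _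
    rw [leadingCoeff_finSuccEquiv_frobDet hq1 he]
    exact (dvd_neg_one_pow_mul _).mp dvd_rfl

end MvPolynomial

/-! ### A largest exponent that is not a multiple of the common difference -/

/-- A uses up the only factor π of the leading coefficient, so C keeps its degree modulo π, where it
divides a polynomial of degree m. -/
theorem natDegree_le_of_prime_dvd_leadingCoeff {R : Type*} [CommRing R] [IsDomain R] {π : R}
    (hπ : Prime π) {A C : Polynomial R} {m : ℕ} (hA : π ∣ A.leadingCoeff)
    (hlc : ¬ π * π ∣ (A * C).leadingCoeff) (hm : ¬ π ∣ (A * C).coeff m)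
    (hgt : ∀ i, m < i → π ∣ (A * C).coeff i) : C.natDegree ≤ m := by
  have hprime : (Ideal.span {π}).IsPrime := (Ideal.span_singleton_prime hπ.ne_zero).mpr hπ
  set f := Ideal.Quotient.mk (Ideal.span {π})
  have hf : ∀ x, f x = 0 ↔ π ∣ x := fun x => by
    rw [Ideal.Quotient.eq_zero_iff_mem, Ideal.mem_span_singleton]
  have hC : ¬ π ∣ C.leadingCoeff := fun h => hlc (by
    rw [Polynomial.leadingCoeff_mul]; exact mul_dvd_mul hA h)
  have h1 : (C.map f).natDegree = C.natDegree :=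
    Polynomial.natDegree_map_of_leadingCoeff_ne_zero f (fun h => hC ((hf _).mp h))
  have h2 : (A * C).map f ≠ 0 := fun h => hm (by
    rw [← hf, ← Polynomial.coeff_map, h, Polynomial.coeff_zero])
  rw [← h1]
  refine (Polynomial.natDegree_le_of_dvd ?_ h2).trans ?_
  · rw [Polynomial.map_mul]; exact dvd_mul_left _ _
  · rw [Polynomial.natDegree_le_iff_coeff_eq_zero]
    intro i hi
    rw [Polynomial.coeff_map, hf]
    exact hgt i hi

/-- Take a primitive root of unity of order q^d - 1 and use gcd(q^d - 1, q^E - 1) = q^gcd(d, E) - 1.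
-/
theorem exists_pow_eq_self_and_ne {L : Type*} [Field L] [IsAlgClosed L] (q : ℕ) (hq1 : 1 < q)
    (hq : (q : L) = 0) {d E : ℕ} (hd : 0 < d) (hdE : ¬ d ∣ E) :
    ∃ u : L, u ^ q ^ d = u ∧ u ^ q ^ E ≠ u := by
  have h1 : 1 < q ^ d := Nat.one_lt_pow hd.ne' hq1
  have hne : NeZero ((q ^ d - 1 : ℕ) : L) := ⟨by
    rw [Nat.cast_sub h1.le, Nat.cast_pow, hq, zero_pow hd.ne']
    simp⟩
  have hne' : NeZero (q ^ d - 1) := ⟨by omega⟩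
  obtain ⟨u, hu⟩ := HasEnoughRootsOfUnity.exists_primitiveRoot L (q ^ d - 1)
  have hu0 : u ≠ 0 := hu.ne_zero hne'.out
  refine ⟨u, ?_, fun h => hdE ?_⟩
  · rw [← Nat.sub_add_cancel h1.le, pow_succ, hu.pow_eq_one, one_mul]
  · have h2 : u ^ (q ^ E - 1) = 1 := by
      have h3 : 1 ≤ q ^ E := Nat.one_le_pow _ _ (by omega)
      rw [← Nat.sub_add_cancel h3, pow_succ] at h
      exact mul_right_cancel₀ hu0 (by rw [h, one_mul])
    have h3 := hu.dvd_of_pow_eq_one _ h2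
    have h4 := Nat.pow_sub_one_gcd_pow_sub_one q d E
    rw [Nat.gcd_eq_left h3] at h4
    have h5 : q ^ d = q ^ Nat.gcd d E := by
      have : 1 ≤ q ^ Nat.gcd d E := Nat.one_le_pow _ _ (by omega)
      omega
    have h6 := Nat.pow_right_injective hq1 h5
    rw [h6]
    exact Nat.gcd_dvd_right d E

/-- Subtract u times a determinant with two equal rows. The terms whose exponent satisfies u ^ q ^ e
c = u then drop out. -/
theorem frobDet_cons_mul {R : Type*} [CommRing R] (q : ℕ) {k : ℕ} (u : R) (x : Fin (k + 1) → R)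
    (e : Fin (k + 2) → ℕ) :
    frobDet q (Fin.cons (u * x 0) x : Fin (k + 2) → R) e =
      ∑ c, (u ^ q ^ e c - u) * x 0 ^ q ^ e c * frobCoeff q x e c := by
  have h : frobDet q (Fin.cons (x 0) x : Fin (k + 2) → R) e = 0 :=
    Matrix.det_zero_of_row_eq (i := 0) (j := 1) (by simp) (by ext c; simp)
  rw [← sub_zero (frobDet q _ e), ← mul_zero u, ← h, frobDet_cons, frobDet_cons, sparsePoly,
    Polynomial.eval_finsetSum, Polynomial.eval_finsetSum, Finset.mul_sum, ← Finset.sum_sub_distrib]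
  refine Finset.sum_congr rfl fun c _ => ?_
  simp [mul_pow]
  ring

namespace MvPolynomial

variable {L : Type*} [Field L]

theorem finSuccEquiv_symm_X_sub_C_dvd_iff {k : ℕ} (a : MvPolynomial (Fin k) L)
    (P : MvPolynomial (Fin (k + 1)) L) :
    (finSuccEquiv L k).symm (Polynomial.X - Polynomial.C a) ∣ P ↔
      (finSuccEquiv L k P).eval a = 0 := by
  rw [← map_dvd_iff (finSuccEquiv L k), AlgEquiv.apply_symm_apply, Polynomial.dvd_iff_isRoot,
    Polynomial.IsRoot.def]

theorem prime_finSuccEquiv_symm_X_sub_C {k : ℕ} (a : MvPolynomial (Fin k) L) :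
    Prime ((finSuccEquiv L k).symm (Polynomial.X - Polynomial.C a)) :=
  (MulEquiv.prime_iff (finSuccEquiv L k).symm).mpr (Polynomial.prime_X_sub_C a)

theorem eval_finSuccEquiv_frobDet {k : ℕ} (q : ℕ) (u : L) (e : Fin (k + 2) → ℕ) :
    (finSuccEquiv L (k + 1) (frobDet q X e)).eval (C u * X 0) =
      ∑ c, (C (u ^ q ^ e c - u) : MvPolynomial (Fin (k + 1)) L) * X 0 ^ q ^ e c *
        frobCoeff q X e c := by
  rw [finSuccEquiv_frobDet, ← frobDet_cons, frobDet_cons_mul]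
  simp

theorem natDegree_finSuccEquiv_frobDet {q : ℕ} (hq : 1 < q) {k : ℕ} {e : Fin (k + 1) → ℕ}
    (he : StrictMono e) :
    (finSuccEquiv L k (frobDet q X e)).natDegree = q ^ e (Fin.last k) := by
  rw [finSuccEquiv_frobDet]
  refine natDegree_sparsePoly _ ((pow_right_strictMono₀ hq).comp he) ?_
  refine mul_ne_zero (pow_ne_zero _ (neg_ne_zero.mpr one_ne_zero)) ?_
  exact frobDet_X_ne_zero L q hq (he.comp (Fin.strictMono_succAbove _))

/-- If the exponents other than the largest one are the multiples `0, d, …, (k + 1) * d` of `d`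
and the largest one is not a multiple of `d`, then the Moore determinant has a factor of large
degree in its first variable. -/
theorem hasStableFactor_of_not_dvd [IsAlgClosed L] {φ : L ≃+* L} {q : ℕ} (hq1 : 1 < q)
    (hq : (q : L) = 0) {k : ℕ} {e : Fin (k + 4) → ℕ} (he : StrictMono e) {d : ℕ}
    (hd : ∀ j : Fin (k + 3), e j.castSucc = j * d) (hE : ¬ d ∣ e (Fin.last _)) :
    HasStableFactor φ (frobDet q X (fun c : Fin (k + 4) => (c : ℕ))) (frobDet q X e) := by
  set E := e (Fin.last (k + 3)) with hEdef
  have hd1 : 1 < d := by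
    have h1 := he (show (0 : Fin (k + 4)) < 1 by simp)
    have h2 := hd 1
    have h3 := hd 0
    simp only [Fin.castSucc_zero, Fin.castSucc_one, Fin.val_zero, Fin.val_one, zero_mul,
      one_mul] at h2 h3
    rw [h2, h3] at h1
    rcases Nat.lt_or_ge 1 d with h | h
    · exact h
    · exact absurd (show d ∣ E by rw [show d = 1 by omega]; exact one_dvd _) hE
  have hElt : (k + 2) * d < E := by
    have h1 := he (Fin.castSucc_lt_last (Fin.last (k + 2)))
    rwa [hd, Fin.val_last] at h1
  set m := q ^ ((k + 2) * d) with hm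
  have hqE : 2 * m ≤ q ^ E :=
    calc 2 * m ≤ q * m := Nat.mul_le_mul_right _ hq1
      _ = q ^ ((k + 2) * d + 1) := by rw [pow_succ]; ring
      _ ≤ q ^ E := Nat.pow_le_pow_right (by omega) hElt
  have hmG : q ^ (k + 3) < m := by
    refine Nat.pow_lt_pow_right hq1 ?_
    nlinarith
  obtain ⟨u, hu, huE⟩ := exists_pow_eq_self_and_ne (L := L) q hq1 hq (by omega : 0 < d) hE
  have hu' : ∀ j, u ^ q ^ (j * d) = u := by
    intro j
    induction j with
    | zero => simp
    | succ j ih => rw [add_mul, one_mul, pow_add, pow_mul, ih, hu]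
  -- The linear form X_0 - u X_1 in the remaining variables. It divides the leading coefficient,
  -- whose exponents are multiples of d, but not the coefficient at m, where the exponent E
  -- survives.
  set π := (finSuccEquiv L (k + 2)).symm (Polynomial.X - Polynomial.C (C u * X 0)) with hπdef
  have hπ : Prime π := prime_finSuccEquiv_symm_X_sub_C _
  have hlc := leadingCoeff_finSuccEquiv_frobDet (L := L) hq1 he
  have hdvd_lc : π ∣ (finSuccEquiv L (k + 3) (frobDet q X e)).leadingCoeff := by
    rw [hlc, dvd_neg_one_pow_mul, finSuccEquiv_symm_X_sub_C_dvd_iff, eval_finSuccEquiv_frobDet]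
    refine Finset.sum_eq_zero fun c _ => ?_
    rw [hd, hu', sub_self, C_0, zero_mul, zero_mul]
  have hsq : ¬ π * π ∣ (finSuccEquiv L (k + 3) (frobDet q X e)).leadingCoeff := by
    rw [hlc, dvd_neg_one_pow_mul]
    exact not_mul_self_dvd_frobDet L hq1 hq (he.comp Fin.strictMono_castSucc)
      (by simpa using hd 0) hπ.irreducible
  have hinj := ((pow_right_strictMono₀ hq1).comp he).injective
  have hcm : ¬ π ∣ (finSuccEquiv L (k + 3) (frobDet q X e)).coeff m := by
    have hm' : m = q ^ e (Fin.last (k + 2)).castSucc := by rw [hd, Fin.val_last]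
    have hcoeff := coeff_sparsePoly (frobCoeff q (X : Fin (k + 3) → MvPolynomial _ L) e) hinj
      (Fin.last (k + 2)).castSucc
    rw [Function.comp_def] at hcoeff
    rw [finSuccEquiv_frobDet, hm', hcoeff, frobCoeff, dvd_neg_one_pow_mul,
      finSuccEquiv_symm_X_sub_C_dvd_iff, eval_finSuccEquiv_frobDet, Finset.sum_eq_single
      (Fin.last (k + 2))]
    · rw [show (Fin.last (k + 2)).castSucc.succAbove (Fin.last (k + 2)) = Fin.last (k + 3) by
        rw [Fin.succAbove_castSucc_self, Fin.succ_last]]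
      refine mul_ne_zero (mul_ne_zero ?_ (pow_ne_zero _ (X_ne_zero _))) ?_
      · rw [Ne, C_eq_zero, sub_eq_zero]
        exact huE
      · refine mul_ne_zero (pow_ne_zero _ (neg_ne_zero.mpr one_ne_zero)) ?_
        exact frobDet_X_ne_zero L q hq1 ((he.comp (Fin.strictMono_succAbove _)).comp
          (Fin.strictMono_succAbove _))
    · intro c _ hc
      obtain ⟨c, rfl⟩ := Fin.exists_castSucc_eq.mpr hc
      rw [Fin.succAbove_of_castSucc_lt _ _ (by simp [Fin.castSucc_lt_last]), hd, hu', sub_self,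
        C_0, zero_mul, zero_mul]
    · simp
  have hgt : ∀ i, m < i → π ∣ (finSuccEquiv L (k + 3) (frobDet q X e)).coeff i := by
    intro i hi
    by_cases hiE : i = q ^ E
    · have hdeg := natDegree_finSuccEquiv_frobDet (L := L) hq1 he
      rw [hiE, ← hdeg]
      exact hdvd_lc
    · rw [finSuccEquiv_frobDet, coeff_sparsePoly_of_ne]
      · exact dvd_zero _
      · intro c
        refine Fin.lastCases (Ne.symm hiE) (fun c => ?_) c
        refine (lt_of_le_of_lt (Nat.pow_le_pow_right (by omega) ?_) hi).ne
        rw [hd]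
        exact Nat.mul_le_mul_right _ (by omega)
  have hFne := frobDet_X_ne_zero L q hq1 he
  have hnat : _ = q ^ E := natDegree_finSuccEquiv_frobDet (L := L) hq1 he
  have hbound : ∀ A C : MvPolynomial (Fin (k + 4)) L, frobDet q X e = A * C →
      π ∣ (finSuccEquiv L (k + 3) A).leadingCoeff →
      (finSuccEquiv L (k + 3) C).natDegree ≤ m ∧ m ≤ (finSuccEquiv L (k + 3) A).natDegree := by
    intro A C hAC hA
    have hne : A * C ≠ 0 := hAC ▸ hFne
    rw [hAC] at hsq hcm hgt hnat
    rw [map_mul] at hsq hcm hgt hnat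
    have h1 := natDegree_le_of_prime_dvd_leadingCoeff hπ hA hsq hcm hgt
    rw [Polynomial.natDegree_mul] at hnat
    · exact ⟨h1, by omega⟩
    · exact (map_ne_zero_iff _ (finSuccEquiv L _).injective).mpr (left_ne_zero_of_mul hne)
    · exact (map_ne_zero_iff _ (finSuccEquiv L _).injective).mpr (right_ne_zero_of_mul hne)
  obtain ⟨A, hA, ⟨C₀, hAC⟩, hAπ⟩ := exists_irreducible_dvd_of_prime_dvd_map
    (Polynomial.leadingCoeffHom.comp
      (finSuccEquiv L (k + 3) : _ →* Polynomial (MvPolynomial (Fin (k + 3)) L))) hπ hFne hdvd_lc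
  change π ∣ (finSuccEquiv L (k + 3) A).leadingCoeff at hAπ
  have hAm := (hbound A C₀ hAC hAπ).2
  refine ⟨A, hA, ⟨C₀, hAC⟩, ?_, ?_⟩
  · intro hAG
    have hG := frobDet_X_ne_zero L q hq1 (e := fun c : Fin (k + 4) => (c : ℕ)) Fin.val_strictMono
    have h1 := Polynomial.natDegree_le_of_dvd (map_dvd (finSuccEquiv L (k + 3)) hAG)
      ((map_ne_zero_iff _ (finSuccEquiv L _).injective).mpr hG)
    rw [natDegree_finSuccEquiv_frobDet hq1 Fin.val_strictMono, Fin.val_last] at h1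
    omega
  · have hφA := irreducible_map_ringEquiv (φ := φ) hA
    have hφF := map_frobDet_X (L := L) (φ := φ) q e
    refine (associated_of_not_mul_dvd hA hφA ⟨C₀, hAC⟩ (hφF ▸ map_dvd _ ⟨C₀, hAC⟩) ?_).symm
    -- The cofactor of A has degree at most m, yet it would contain φ A, of degree at least m, and
    -- also X_0. The extra X_0 is needed because q^E = 2m can occur.
    rintro ⟨S, hS⟩
    have hdegφ : (finSuccEquiv L (k + 3) (map (φ : L →+* L) A)).natDegree =
        (finSuccEquiv L (k + 3) A).natDegree := by
      rw [finSuccEquiv_map_eq]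
      exact Polynomial.natDegree_map_eq_of_injective (map_injective _ (φ : L →+* L).injective) _
    have hX : Prime (X 0 : MvPolynomial (Fin (k + 4)) L) := X_prime
    have hXF : X 0 ∣ frobDet q (X : Fin (k + 4) → MvPolynomial _ L) e := by
      rw [frobDet_succ q _ e 0]
      refine Finset.dvd_sum fun c _ => ?_
      exact ((dvd_pow_self _ (pow_ne_zero _ (by omega))).mul_left _).mul_right _
    have hX1 : ∀ B : MvPolynomial (Fin (k + 4)) L, Irreducible B → X 0 ∣ B →
        (finSuccEquiv L (k + 3) B).natDegree ≤ 1 := by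
      intro B hB h
      have h2 := (hB.dvd_irreducible_iff_associated hX.irreducible).mpr
        (hX.irreducible.associated_of_dvd hB h).symm
      refine (Polynomial.natDegree_le_of_dvd (map_dvd (finSuccEquiv L (k + 3)) h2) ?_).trans ?_
      · rw [finSuccEquiv_X_zero]; exact Polynomial.X_ne_zero
      · rw [finSuccEquiv_X_zero]; exact Polynomial.natDegree_X_le
    have hm1 : 1 < m := lt_of_le_of_lt (Nat.one_le_pow _ _ (by omega)) hmG
    have hS0 : S ≠ 0 := by
      rintro rfl
      rw [mul_zero] at hS
      exact hFne hS
    have hSX : X 0 ∣ S := by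
      rw [hS] at hXF
      refine (hX.dvd_or_dvd hXF).resolve_left fun h => ?_
      rcases hX.dvd_or_dvd h with h | h
      · have := hX1 _ hA h; omega
      · have := hX1 _ hφA h; omega
    have hS1 : 1 ≤ (finSuccEquiv L (k + 3) S).natDegree := by
      refine le_trans ?_ (Polynomial.natDegree_le_of_dvd (map_dvd (finSuccEquiv L (k + 3)) hSX)
        ((map_ne_zero_iff _ (finSuccEquiv L _).injective).mpr hS0))
      rw [finSuccEquiv_X_zero, Polynomial.natDegree_X]
    have h3 := (hbound A (map (φ : L →+* L) A * S) (by rw [hS, mul_assoc]) hAπ).1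
    rw [map_mul, Polynomial.natDegree_mul, hdegφ] at h3
    · omega
    · exact (map_ne_zero_iff _ (finSuccEquiv L _).injective).mpr hφA.ne_zero
    · exact (map_ne_zero_iff _ (finSuccEquiv L _).injective).mpr hS0

end MvPolynomial

/-! ### Consecutive exponents with a gap before the last -/

section frobDet

variable {R : Type*} [CommRing R] {q : ℕ}

theorem frobDet_eq_zero_of_eq {k : ℕ} (x : Fin k → R) {e : Fin k → ℕ} {c c' : Fin k} (hne : c ≠ c')
    (h : e c = e c') : frobDet q x e = 0 :=
  Matrix.det_zero_of_column_eq hne fun r => by simp [h]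

theorem dvd_frobDet_iff_of_injective {k : ℕ} (x : Fin k → R) {e : Fin k → ℕ}
    (he : Function.Injective e) (hlt : ∀ c, e c < k) (a : R) :
    a ∣ frobDet q x e ↔ a ∣ frobDet q x (fun c => (c : ℕ)) := by
  let f : Fin k → Fin k := fun c => ⟨e c, hlt c⟩
  have hf : Function.Injective f := fun c c' h => he (congrArg Fin.val h)
  let σ : Equiv.Perm (Fin k) := Equiv.ofBijective f (Finite.injective_iff_bijective.mp hf)
  have h1 : frobDet q x e = Equiv.Perm.sign σ * frobDet q x (fun c => (c : ℕ)) := by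
    rw [frobDet, frobDet, ← Matrix.det_permute']
    rfl
  rw [h1]
  rcases Int.units_eq_one_or (Equiv.Perm.sign σ) with h | h <;> simp [h]

theorem frobDet_eq_sum_update {k : ℕ} {ι : Type*} [Fintype ι] (x : Fin (k + 1) → R)
    (e : Fin (k + 1) → ℕ) (β : ι → R) (f : ι → ℕ)
    (h : ∀ r, x r ^ q ^ e (Fin.last k) = ∑ j, β j * x r ^ q ^ f j) :
    frobDet q x e = ∑ j, β j * frobDet q x (Function.update e (Fin.last k) (f j)) := by
  have hcol : ∀ e' : Fin (k + 1) → ℕ, frobDet q x e' = ∑ r : Fin (k + 1),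
      (-1) ^ (r + k : ℕ) * x r ^ q ^ e' (Fin.last k) *
        frobDet q (fun j => x (r.succAbove j)) (fun j => e' j.castSucc) := by
    intro e'
    rw [frobDet, Matrix.det_succ_column _ (Fin.last k)]
    simp only [Fin.succAbove_last, Fin.val_last]
    rfl
  rw [hcol]
  simp only [hcol, Function.update_self, Finset.mul_sum]
  rw [Finset.sum_comm]
  refine Finset.sum_congr rfl fun r _ => ?_
  rw [h, Finset.mul_sum, Finset.sum_mul]
  refine Finset.sum_congr rfl fun j _ => ?_
  have : ∀ i : Fin k, Function.update e (Fin.last k) (f j) i.castSucc = e i.castSucc := fun i =>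
    Function.update_of_ne (Fin.castSucc_lt_last i).ne _ _
  simp only [this]
  ring

end frobDet

/-- The exponents `0, 1, …, k - 1, k + m`. -/
def gapExp (k m : ℕ) (c : Fin (k + 1)) : ℕ := if (c : ℕ) = k then k + m else c

theorem gapExp_last (k m : ℕ) : gapExp k m (Fin.last k) = k + m := by simp [gapExp]

theorem gapExp_of_lt {k m : ℕ} {c : Fin (k + 1)} (h : (c : ℕ) < k) : gapExp k m c = c := by
  simp [gapExp, h.ne]

theorem gapExp_zero (k m : ℕ) : gapExp (k + 1) m 0 = 0 := gapExp_of_lt (by simp)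

theorem gapExp_strictMono (k m : ℕ) : StrictMono (gapExp k m) := by
  intro c c' h
  have h1 := c.is_lt
  have h2 := c'.is_lt
  have h3 : (c : ℕ) < c' := h
  unfold gapExp
  split_ifs <;> omega

theorem gapExp_succ (k m : ℕ) (j : Fin (k + 1)) :
    gapExp (k + 1) m j.succ = gapExp k m j + 1 := by
  unfold gapExp
  rw [Fin.val_succ]
  split_ifs <;> omega

namespace MvPolynomial

variable {L : Type*} [Field L] (p s : ℕ) [Fact p.Prime] [CharP L p]

/-- The factor `W` of a Moore determinant with exponents `0, 1, …, k, k + 1 + m` does not divide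
the Moore determinant with exponents `0, 2, …, k + 1, k + 2 + m`. -/
theorem not_dvd_frobDet_gapExp_succAbove_one (hq : 1 < p ^ s) {k m : ℕ}
    {W : MvPolynomial (Fin (k + 2)) L} (hW : Irreducible W)
    (hdvd : W ∣ frobDet (p ^ s) X (gapExp (k + 1) m))
    (hM : ¬ W ∣ frobDet (p ^ s) X (fun c : Fin (k + 2) => (c : ℕ))) :
    ¬ W ∣ frobDet (p ^ s) X (fun j : Fin (k + 2) => gapExp (k + 2) m ((1 : Fin (k + 3)).succAbove j)) := by
  intro hdvd'
  -- Expand the column of exponent k + 1 + m over those of exponents 0, …, k + 1. The first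
  -- divisibility forces W to divide the last α, and the second, through the q-th power of the
  -- relation, α 0. Only these two enter the minors without exponent 0, so W would divide all such
  -- minors.
  obtain ⟨α, hα⟩ := exists_pow_eq_sum_fin p s (X : Fin (k + 2) → MvPolynomial _ L) (k + 1 + m)
  have hlast : W ∣ α (Fin.last (k + 1)) := by
    rw [frobDet_eq_sum_update X _ α (fun j => (j : ℕ)) (by rwa [gapExp_last]),
      Finset.sum_eq_single (Fin.last (k + 1))] at hdvd
    · refine (hW.prime.dvd_or_dvd hdvd).resolve_right fun h => hM ?_
      convert h using 2
      ext c
      refine Fin.lastCases ?_ (fun c => ?_) c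
      · simp
      · rw [Function.update_of_ne (Fin.castSucc_lt_last c).ne,
          gapExp_of_lt (Fin.castSucc_lt_last c)]
    · intro j _ hj
      obtain ⟨j, rfl⟩ := Fin.exists_castSucc_eq.mpr hj
      rw [frobDet_eq_zero_of_eq (c := j.castSucc) (c' := Fin.last _) _ (Fin.castSucc_lt_last j).ne,
        mul_zero]
      rw [Function.update_self, Function.update_of_ne (Fin.castSucc_lt_last j).ne,
        gapExp_of_lt (Fin.castSucc_lt_last j)]
    · simp
  have hone : ∀ c : Fin (k + 2), gapExp (k + 2) m ((1 : Fin (k + 3)).succAbove c) =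
      if (c : ℕ) = 0 then 0 else if (c : ℕ) = k + 1 then k + 2 + m else c + 1 := by
    intro c
    refine Fin.cases ?_ (fun c => ?_) c
    · simp [gapExp_zero]
    · rw [← Fin.succ_zero_eq_one, Fin.succ_succAbove_succ, Fin.zero_succAbove]
      simp only [gapExp, Fin.val_succ]
      rw [if_neg (Nat.succ_ne_zero _)]
      split_ifs <;> omega
  have hzero : W ∣ α 0 := by
    have hα' : ∀ r : Fin (k + 2), (X r : MvPolynomial _ L) ^ (p ^ s) ^
        gapExp (k + 2) m ((1 : Fin (k + 3)).succAbove (Fin.last (k + 1))) =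
        ∑ j, α j ^ p ^ s * X r ^ (p ^ s) ^ ((j : ℕ) + 1) := by
      intro r
      rw [hone, Fin.val_last, if_neg (by omega), if_pos rfl,
        show k + 2 + m = (k + 1 + m) + 1 by ring, pow_succ, pow_mul, hα, sum_pow_char_pow]
      refine Finset.sum_congr rfl fun j _ => ?_
      rw [mul_pow, ← pow_mul, ← pow_succ]
    rw [frobDet_eq_sum_update X _ (fun j => α j ^ p ^ s) (fun j : Fin (k + 2) => (j : ℕ) + 1) hα',
      Fin.sum_univ_succ, Fin.sum_univ_castSucc, Finset.sum_eq_zero, zero_add, Fin.succ_last] at hdvd'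
    · rw [dvd_add_left ((dvd_pow hlast (by omega)).mul_right _)] at hdvd'
      refine hW.prime.dvd_of_dvd_pow ((hW.prime.dvd_or_dvd hdvd').resolve_right fun h => hM ?_)
      refine (dvd_frobDet_iff_of_injective _ ?_ ?_ _).mp h
      · intro c c' h
        have h1 := c.is_lt
        have h2 := c'.is_lt
        simp only [Function.update_apply, hone, Fin.ext_iff, Fin.val_last, Fin.val_zero] at h
        ext
        split_ifs at h <;> omega
      · intro c
        have h1 := c.is_lt
        simp only [Function.update_apply, hone, Fin.ext_iff, Fin.val_last, Fin.val_zero]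
        split_ifs <;> omega
    · intro j _
      have h1 := j.is_lt
      rw [frobDet_eq_zero_of_eq (c := j.castSucc.succ) (c' := Fin.last _) _, mul_zero]
      · rw [Ne, Fin.ext_iff]; simp; omega
      · rw [Function.update_self, Function.update_of_ne, hone]
        · simp; omega
        · rw [Ne, Fin.ext_iff]; simp; omega
  obtain ⟨r, hr⟩ := exists_not_dvd_frobDet_succAbove L hq (gapExp_strictMono (k + 1) m) hW
  apply hr
  have hα' : ∀ i : Fin (k + 1), (X (r.succAbove i) : MvPolynomial (Fin (k + 2)) L) ^ (p ^ s) ^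
      gapExp (k + 1) m (Fin.last k).succ = ∑ j, α j * X (r.succAbove i) ^ (p ^ s) ^ (j : ℕ) := by
    intro i
    rw [Fin.succ_last, gapExp_last, hα]
  rw [frobDet_eq_sum_update _ (fun j : Fin (k + 1) => gapExp (k + 1) m j.succ) α
    (fun j => (j : ℕ)) hα']
  refine Finset.dvd_sum fun j _ => ?_
  by_cases hj0 : j = 0
  · rw [hj0]; exact hzero.mul_right _
  by_cases hjl : j = Fin.last _
  · rw [hjl]; exact hlast.mul_right _
  have hj1 : (j : ℕ) ≠ 0 := fun h => hj0 (Fin.ext h)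
  have hj2 : (j : ℕ) ≠ k + 1 := fun h => hjl (Fin.ext h)
  have hj3 := j.is_lt
  have hne : (⟨(j : ℕ) - 1, by omega⟩ : Fin (k + 1)) ≠ Fin.last k := by
    rw [Ne, Fin.ext_iff]; simp; omega
  rw [frobDet_eq_zero_of_eq (c := ⟨(j : ℕ) - 1, by omega⟩) (c' := Fin.last _) _ hne, mul_zero]
  · exact dvd_zero _
  · rw [Function.update_self, Function.update_of_ne hne, gapExp_of_lt]
    · simp; omega
    · simp; omega

/-- The quotient of a Moore determinant by its first variable. -/
noncomputable def frobDetDivX (L : Type*) [Field L] (q : ℕ) {k : ℕ} (e : Fin (k + 1) → ℕ) :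
    MvPolynomial (Fin (k + 1)) L :=
  (finSuccEquiv L k).symm (sparsePoly (frobCoeff q X e) (fun c => q ^ e c - 1))

theorem X_mul_frobDetDivX {q : ℕ} (hq : 1 < q) {k : ℕ} (e : Fin (k + 1) → ℕ) :
    X 0 * frobDetDivX L q e = frobDet q X e := by
  apply (finSuccEquiv L k).injective
  rw [map_mul, finSuccEquiv_X_zero, frobDetDivX, AlgEquiv.apply_symm_apply, finSuccEquiv_frobDet,
    X_mul_sparsePoly _ fun c => Nat.pow_pos (by omega)]

theorem coeff_frobDetDivX {q : ℕ} (hq : 1 < q) {k : ℕ} {e : Fin (k + 1) → ℕ} (he : StrictMono e)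
    (c : Fin (k + 1)) :
    (finSuccEquiv L k (frobDetDivX L q e)).coeff (q ^ e c - 1) = frobCoeff q X e c := by
  rw [frobDetDivX, AlgEquiv.apply_symm_apply]
  refine coeff_sparsePoly _ (f := fun c => q ^ e c - 1) (fun c c' h => he.injective ?_) c
  have h1 : 0 < q ^ e c := Nat.pow_pos (by omega)
  have h2 : 0 < q ^ e c' := Nat.pow_pos (by omega)
  simp only at h
  exact Nat.pow_right_injective hq (show q ^ e c = q ^ e c' by omega)

theorem coeff_frobDetDivX_of_ne {q : ℕ} {k : ℕ} {e : Fin (k + 1) → ℕ} {n : ℕ}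
    (h : ∀ c, q ^ e c - 1 ≠ n) : (finSuccEquiv L k (frobDetDivX L q e)).coeff n = 0 := by
  rw [frobDetDivX, AlgEquiv.apply_symm_apply]
  exact coeff_sparsePoly_of_ne _ h

/-- θ is the constant coefficient in X_0, applied after dividing by X_0 because F itself has none.
A' divides the image exactly q times, and does not divide the coefficient of degree q - 1; the edge
from (0, q) to (q - 1, 0) keeps A' from dividing the images of two factors. -/
theorem hasStableFactor_gapExp_succ {φ : L ≃+* L} (hs : s ≠ 0) {k m : ℕ}
    (h : HasStableFactor φ (frobDet (p ^ s) X (fun c : Fin (k + 2) => (c : ℕ)))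
      (frobDet (p ^ s) X (gapExp (k + 1) m))) :
    HasStableFactor φ (frobDet (p ^ s) X (fun c : Fin (k + 3) => (c : ℕ)))
      (frobDet (p ^ s) X (gapExp (k + 2) m)) := by
  obtain ⟨A', hA', hdvd, hM, hφ⟩ := h
  have hq : 1 < p ^ s := Nat.one_lt_pow hs (Fact.out : p.Prime).one_lt
  have hq0 : ((p ^ s : ℕ) : L) = 0 := by simp [hs]
  set q := p ^ s with hqdef
  have hI := gapExp_strictMono (k + 2) m
  have hJ := gapExp_strictMono (k + 1) m
  have hcoeff0 : ∀ e : Fin (k + 3) → ℕ, ∀ e' : Fin (k + 2) → ℕ, StrictMono e → e 0 = 0 →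
      (∀ j, e j.succ = e' j + 1) →
      (finSuccEquiv L (k + 2) (frobDetDivX L q e)).coeff 0 = frobDet q X e' ^ q := by
    intro e e' he he0 hee'
    have h1 := coeff_frobDetDivX (L := L) hq he 0
    rw [he0, pow_zero, Nat.sub_self] at h1
    rw [h1, frobCoeff, Fin.val_zero, pow_zero, one_mul]
    simp only [Fin.zero_succAbove, hee']
    have := frobDet_add p s 1 (X : Fin (k + 2) → MvPolynomial _ L) e'
    rwa [pow_one] at this
  have hFJ := hcoeff0 _ _ hI (gapExp_zero _ _) (gapExp_succ _ _)
  have hMJ := hcoeff0 (fun c => (c : ℕ)) (fun c => (c : ℕ)) Fin.val_strictMono rfl Fin.val_succ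
  have hXF := X_mul_frobDetDivX (L := L) hq (gapExp (k + 2) m)
  have hXM := X_mul_frobDetDivX (L := L) hq (fun c : Fin (k + 3) => (c : ℕ))
  have hF0 := frobDet_X_ne_zero L q hq hI
  have hone : gapExp (k + 2) m 1 = 1 := gapExp_of_lt (by simp)
  have hstable : HasStableFactor φ (frobDetDivX L q (fun c : Fin (k + 3) => (c : ℕ)))
      (frobDetDivX L q (gapExp (k + 2) m)) := by
    refine hasStableFactor_of_monoidHom (((Polynomial.constantCoeff :
      Polynomial (MvPolynomial (Fin (k + 2)) L) →+* _) : _ →* _).comp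
      (finSuccEquiv L (k + 2) : _ →* Polynomial (MvPolynomial (Fin (k + 2)) L))) ?_ hA' hφ ?_ ?_
      ?_ ?_ ?_
    · intro A
      change (finSuccEquiv L (k + 2) (map (φ : L →+* L) A)).coeff 0 =
        map (φ : L →+* L) ((finSuccEquiv L (k + 2) A).coeff 0)
      rw [finSuccEquiv_map_eq, Polynomial.coeff_map]
    · rintro h0
      rw [h0, mul_zero] at hXF
      exact hF0 hXF.symm
    · have h1 := map_frobDet_X (L := L) (φ := φ) q (gapExp (k + 2) m)
      rw [← hXF, map_mul, map_X] at h1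
      exact mul_left_cancel₀ (X_ne_zero _) h1
    · change _ ∣ (finSuccEquiv L (k + 2) _).coeff 0
      rw [hFJ]
      exact dvd_pow hdvd (by omega)
    · change ¬ _ ∣ (finSuccEquiv L (k + 2) _).coeff 0
      rw [hMJ]
      exact fun h => hM (hA'.prime.dvd_of_dvd_pow h)
    · rintro A B ⟨S, hS⟩ ⟨hA, hB⟩
      change _ ∣ (finSuccEquiv L (k + 2) A).coeff 0 at hA
      change _ ∣ (finSuccEquiv L (k + 2) B).coeff 0 at hB
      have hS' : finSuccEquiv L (k + 2) (frobDetDivX L q (gapExp (k + 2) m)) =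
          finSuccEquiv L (k + 2) A * finSuccEquiv L (k + 2) (B * S) := by
        rw [hS, mul_assoc, map_mul]
      refine not_dvd_coeff_zero_of_newton_edge hA'.prime (m := q) (n := q - 1) (by omega)
        ?_ (finSuccEquiv L (k + 2) A) (finSuccEquiv L (k + 2) (B * S)) ?_ ?_ ?_ ⟨hA, ?_⟩
      · obtain ⟨n, hn⟩ := Nat.exists_eq_add_of_lt hq
        rw [hn]
        simp
      · rw [← hS']
        have h1 := coeff_frobDetDivX (L := L) hq hI 1
        rw [hone, pow_one] at h1
        rw [h1, frobCoeff, dvd_neg_one_pow_mul]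
        exact not_dvd_frobDet_gapExp_succAbove_one p s hq hA' hdvd hM
      · rw [← hS', hFJ]
        obtain ⟨C, hC⟩ := hdvd
        have hC' : ¬ A' ∣ C := by
          rintro ⟨D, rfl⟩
          exact not_mul_self_dvd_frobDet L hq hq0 hJ (gapExp_zero _ _) hA'
            ⟨D, by rw [hC, mul_assoc]⟩
        rw [hC, mul_pow, pow_succ]
        intro h
        exact hC' (hA'.prime.dvd_of_dvd_pow
          ((mul_dvd_mul_iff_left (pow_ne_zero _ hA'.ne_zero)).mp h))
      · intro i v hiv
        rw [← hS']
        have hi : i < q - 1 := by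
          by_contra! hi
          have := Nat.mul_le_mul_left q hi
          have : 0 ≤ (q - 1) * v := Nat.zero_le _
          omega
        obtain rfl | hi0 := Nat.eq_zero_or_pos i
        · rw [hFJ]
          have hv : v < q := by
            by_contra! hv
            have := Nat.mul_le_mul_left (q - 1) hv
            have := mul_comm q (q - 1)
            omega
          exact (pow_dvd_pow _ hv).trans (pow_dvd_pow_of_dvd hdvd _)
        · rw [coeff_frobDetDivX_of_ne]
          · exact dvd_zero _
          · intro c hc
            obtain rfl | ⟨c, rfl⟩ := Fin.eq_zero_or_eq_succ c
            · rw [gapExp_zero, pow_zero] at hc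
              omega
            · rw [gapExp_succ] at hc
              have h1 : q ^ 1 ≤ q ^ (gapExp (k + 1) m c + 1) :=
                Nat.pow_le_pow_right (by omega) (by omega)
              rw [pow_one] at h1
              omega
      · rw [map_mul, Polynomial.mul_coeff_zero]
        exact hB.mul_right _
  -- Restoring X_0 is harmless: X_0 does not divide F/X_0, whose constant coefficient is nonzero, so
  -- A is not associated to it.
  obtain ⟨A, hA, hAF, hAM, hAφ⟩ := hstable
  refine ⟨A, hA, hXF ▸ hAF.mul_left _, fun h => ?_, hAφ⟩
  rw [← hXM] at h
  have hAX := (hA.prime.dvd_or_dvd h).resolve_right hAM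
  have hX : Prime (X 0 : MvPolynomial (Fin (k + 3)) L) := X_prime
  have h1 : X 0 ∣ frobDetDivX L q (gapExp (k + 2) m) :=
    ((hA.associated_of_dvd hX.irreducible hAX).symm.dvd).trans hAF
  have h2 := map_dvd (finSuccEquiv L (k + 2)) h1
  rw [finSuccEquiv_X_zero, Polynomial.X_dvd_iff, hFJ] at h2
  exact frobDet_X_ne_zero L q hq hJ (pow_eq_zero_iff (by omega) |>.mp h2)

end MvPolynomial

/-! ### Three variables: local analysis at singular points -/

theorem add_pow_pow_char_pow {R : Type*} [CommRing R] (p s : ℕ) [Fact p.Prime] [CharP R p]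
    (n : ℕ) (a b : R) : (a + b) ^ (p ^ s) ^ n = a ^ (p ^ s) ^ n + b ^ (p ^ s) ^ n := by
  rw [← pow_mul, add_pow_char_pow]

theorem pow_pow_eq_self {R : Type*} [Monoid R] {q : ℕ} {a : R} (h : a ^ q = a) (n : ℕ) :
    a ^ q ^ n = a := by
  induction n with
  | zero => simp
  | succ n ih => rw [pow_succ, pow_mul, ih, h]

theorem frobDet_fin_two {R : Type*} [CommRing R] (q : ℕ) (x : Fin 2 → R) (e : Fin 2 → ℕ) :
    frobDet q x e = x 0 ^ q ^ e 0 * x 1 ^ q ^ e 1 - x 0 ^ q ^ e 1 * x 1 ^ q ^ e 0 := by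
  rw [frobDet, Matrix.det_fin_two]
  simp

/-- Subtracting a combination of the other rows from one row of a Moore determinant. -/
theorem frobDet_insertNth {R : Type*} [CommRing R] (p s : ℕ) [Fact p.Prime] [CharP R p] {k : ℕ}
    (r : Fin (k + 1)) (t : R) (y b : Fin k → R) (hb : ∀ a, b a ^ p ^ s = b a)
    (e : Fin (k + 1) → ℕ) :
    frobDet (p ^ s) (r.insertNth (t + ∑ a, b a * y a) y : Fin (k + 1) → R) e =
      ∑ c : Fin (k + 1), (-1) ^ (r + c : ℕ) * t ^ (p ^ s) ^ e c *
        frobDet (p ^ s) y (fun j => e (c.succAbove j)) := by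
  have hrow : ∀ a, ∑ c : Fin (k + 1), (-1) ^ (r + c : ℕ) * y a ^ (p ^ s) ^ e c *
      frobDet (p ^ s) y (fun j => e (c.succAbove j)) = 0 := by
    intro a
    have h : frobDet (p ^ s) (r.insertNth (y a) y : Fin (k + 1) → R) e = 0 :=
      Matrix.det_zero_of_row_eq (Fin.succAbove_ne r a) (by ext c; simp)
    rw [frobDet_succ _ _ _ r] at h
    simpa using h
  rw [frobDet_succ _ _ _ r]
  simp only [Fin.insertNth_apply_same, Fin.insertNth_apply_succAbove]
  have hpow : ∀ n, (t + ∑ a, b a * y a) ^ (p ^ s) ^ n =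
      t ^ (p ^ s) ^ n + ∑ a, b a * y a ^ (p ^ s) ^ n := by
    intro n
    rw [add_pow_pow_char_pow, ← pow_mul, sum_pow_char_pow]
    simp only [mul_pow, pow_mul, pow_pow_eq_self (hb _)]
  simp only [hpow, mul_add, add_mul, Finset.sum_add_distrib, Finset.mul_sum, Finset.sum_mul]
  rw [Finset.sum_comm]
  rw [add_eq_left]
  refine Finset.sum_eq_zero fun a _ => ?_
  rw [← mul_zero (b a), ← hrow a, Finset.mul_sum]
  refine Finset.sum_congr rfl fun c _ => ?_
  ring

/-- Three elements whose Moore determinant vanishes are linearly dependent over the field of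
elements fixed by `x ↦ x ^ q`. -/
theorem exists_relation_of_frobDet_eq_zero {L : Type*} [Field L] (p s : ℕ) [Fact p.Prime]
    [CharP L p] {P : Fin 3 → L} {j : Fin 3} (hj : P j = 1)
    (h : frobDet (p ^ s) P (fun c => (c : ℕ)) = 0) :
    ∃ (r : Fin 3) (b : Fin 2 → L), (∀ a, b a ^ p ^ s = b a) ∧
      P r = ∑ a, b a * P (r.succAbove a) := by
  set q := p ^ s with hq
  have hsub : ∀ a b : L, (a - b) ^ q = a ^ q - b ^ q := fun a b => sub_pow_char_pow ..
  rw [frobDet, Matrix.det_fin_three] at h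
  simp only [Matrix.of_apply, Fin.val_zero, Fin.val_one, Fin.val_two, pow_zero, pow_one,
    sq q, pow_mul] at h
  -- The cross product of P and P^q. It is orthogonal to P, and the vanishing determinant makes it
  -- proportional to its own q-th power, so ratios of its entries are fixed by x ↦ x^q.
  let c : Fin 3 → L := ![P 1 * P 2 ^ q - P 2 * P 1 ^ q, P 2 * P 0 ^ q - P 0 * P 2 ^ q,
    P 0 * P 1 ^ q - P 1 * P 0 ^ q]
  have hc0 : c 0 = P 1 * P 2 ^ q - P 2 * P 1 ^ q := rfl
  have hc1 : c 1 = P 2 * P 0 ^ q - P 0 * P 2 ^ q := rfl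
  have hc2 : c 2 = P 0 * P 1 ^ q - P 1 * P 0 ^ q := rfl
  have h01 : c 0 * c 1 ^ q = c 1 * c 0 ^ q := by
    rw [hc0, hc1, hsub, hsub, mul_pow, mul_pow, mul_pow, mul_pow]
    linear_combination P 2 ^ q * h
  have h02 : c 0 * c 2 ^ q = c 2 * c 0 ^ q := by
    rw [hc0, hc2, hsub, hsub, mul_pow, mul_pow, mul_pow, mul_pow]
    linear_combination - P 1 ^ q * h
  have h12 : c 1 * c 2 ^ q = c 2 * c 1 ^ q := by
    rw [hc1, hc2, hsub, hsub, mul_pow, mul_pow, mul_pow, mul_pow]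
    linear_combination P 0 ^ q * h
  have hcP : c 0 * P 0 + c 1 * P 1 + c 2 * P 2 = 0 := by
    rw [hc0, hc1, hc2]; ring
  have hcc : ∀ i i', c i * c i' ^ q = c i' * c i ^ q := by
    intro i i'
    fin_cases i <;> fin_cases i' <;> first
      | rfl | exact h01 | exact h02 | exact h12
      | exact h01.symm | exact h02.symm | exact h12.symm
  by_cases hc : ∃ r, c r ≠ 0
  · obtain ⟨r, hr⟩ := hc
    refine ⟨r, fun a => -(c (r.succAbove a) / c r), fun a => ?_, ?_⟩
    · have hneg : ∀ x : L, (-x) ^ q = -x ^ q := by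
        intro x
        have := hsub 0 x
        rwa [zero_sub, zero_pow (pow_ne_zero s (Fact.out : p.Prime).ne_zero), zero_sub] at this
      rw [hneg, div_pow, neg_inj, div_eq_div_iff (pow_ne_zero _ hr) hr]
      linear_combination - hcc (r.succAbove a) r
    · have hsum : c r * P r + ∑ a, c (r.succAbove a) * P (r.succAbove a) = 0 := by
        rw [← Fin.sum_univ_succAbove (fun i => c i * P i) r, Fin.sum_univ_three]
        exact hcP
      have : ∑ a, -(c (r.succAbove a) / c r) * P (r.succAbove a) =
          -(∑ a, c (r.succAbove a) * P (r.succAbove a)) / c r := by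
        rw [← Finset.sum_neg_distrib, Finset.sum_div]
        refine Finset.sum_congr rfl fun a _ => ?_
        ring
      rw [this, eq_div_iff hr]
      linear_combination hsum
  -- Now P is proportional to P^q, and its coordinate 1 makes all coordinates fixed.
  · push Not at hc
    have hfix : ∀ i, P i ^ q = P i := by
      have hcross : ∀ i i', P i * P i' ^ q = P i' * P i ^ q := by
        have e0 := hc 0
        have e1 := hc 1
        have e2 := hc 2
        rw [hc0] at e0
        rw [hc1] at e1
        rw [hc2] at e2
        intro i i'
        fin_cases i <;> fin_cases i' <;> first
          | rfl | exact sub_eq_zero.mp e0 | exact sub_eq_zero.mp e1 | exact sub_eq_zero.mp e2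
          | exact (sub_eq_zero.mp e0).symm
          | exact (sub_eq_zero.mp e1).symm | exact (sub_eq_zero.mp e2).symm
      intro i
      have := hcross j i
      rwa [hj, one_pow, one_mul, mul_one] at this
    obtain ⟨r, hr⟩ := exists_ne j
    refine ⟨r, fun a => if r.succAbove a = j then P r else 0, fun a => ?_, ?_⟩
    · simp only
      split_ifs
      · exact hfix r
      · exact zero_pow (pow_ne_zero s (Fact.out : p.Prime).ne_zero)
    · obtain ⟨a, ha⟩ := Fin.exists_succAbove_eq hr.symm
      rw [Finset.sum_eq_single a]
      · simp only [ha, if_true, hj, mul_one]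
      · intro a' _ ha'
        dsimp only
        rw [if_neg, zero_mul]
        rw [← ha]
        exact fun h => ha' (Fin.succAbove_right_injective h)
      · simp

/-- The determinant with columns `u`, `v`, `w`. -/
def det3 {R : Type*} [CommRing R] (u v w : Fin 3 → R) : R :=
  u 0 * v 1 * w 2 - u 0 * v 2 * w 1 - u 1 * v 0 * w 2 + u 1 * v 2 * w 0 + u 2 * v 0 * w 1 -
    u 2 * v 1 * w 0

theorem frobDet_eq_det3 {R : Type*} [CommRing R] (q : ℕ) (x : Fin 3 → R) (e : Fin 3 → ℕ) :
    frobDet q x e = det3 (fun i => x i ^ q ^ e 0) (fun i => x i ^ q ^ e 1)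
      (fun i => x i ^ q ^ e 2) := by
  rw [frobDet, Matrix.det_fin_three, det3]
  simp only [Matrix.of_apply]
  ring

theorem map_det3 {R S : Type*} [CommRing R] [CommRing S] (f : R →+* S) (u v w : Fin 3 → R) :
    f (det3 u v w) = det3 (fun i => f (u i)) (fun i => f (v i)) (fun i => f (w i)) := by
  simp [det3]

/-- Shaped for the expansions of x, x^q and x^N around a point: S' and T' stand for N-th powers of
the local parameters, so the other terms are the leading ones. -/
theorem det3_expand {R : Type*} [CommRing R] (a b c d : Fin 3 → R) (s t S T S' T' : R) :
    det3 (fun i => b i + s * a i + t * c i) (fun i => c i + S * b i + T * d i)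
      (fun i => c i + S' * b i + T' * d i) =
    S' * det3 (fun i => b i + s * a i + t * c i) (fun i => c i + S * b i + T * d i) b +
    T' * det3 (fun i => b i + s * a i + t * c i) (fun i => c i + S * b i + T * d i) d +
    T * (det3 b d c + s * det3 a d c) + s * S * det3 a b c := by
  simp only [det3]
  ring

open Polynomial in
theorem coeff_zero_coeff_zero_aeval {L : Type*} [Field L] {σ : Type*} (x : σ → L[X][X])
    (P : σ → L) (hx : ∀ i, ((x i).coeff 0).coeff 0 = P i) (A : MvPolynomial σ L) :
    ((MvPolynomial.aeval x A).coeff 0).coeff 0 = MvPolynomial.eval P A := by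
  have h : (constantCoeff.comp (constantCoeff.comp
      (MvPolynomial.aeval x : MvPolynomial σ L →ₐ[L] L[X][X]).toRingHom) : MvPolynomial σ L →+* L) =
      MvPolynomial.eval P := by
    refine MvPolynomial.ringHom_ext (fun a => ?_) fun i => ?_
    · simp [Polynomial.algebraMap_apply]
    · simp [hx]
  exact congrArg (fun f => f A) h

theorem map_aeval_frobDet {L R : Type*} [Field L] [CommRing R] [Algebra L R] (q : ℕ) {k : ℕ}
    (x : Fin k → R) (e : Fin k → ℕ) :
    MvPolynomial.aeval x (frobDet q (MvPolynomial.X : Fin k → MvPolynomial (Fin k) L) e) =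
      frobDet q x e := by
  refine (map_frobDet (MvPolynomial.aeval x : MvPolynomial (Fin k) L →ₐ[L] R).toRingHom q _ e).trans ?_
  simp

section

variable {L : Type*} [Field L] (p s : ℕ) [Fact p.Prime] [CharP L p]

open Polynomial in
/-- At a point over `𝔽_{q ^ (m + 1)}` on no hyperplane over `𝔽_q`, the Moore determinant with
exponents `0, 1, m + 2` has a single branch. -/
theorem not_eval_eq_zero_of_frobDet_ne_zero (hs : s ≠ 0) {m : ℕ} (hm : m ≠ 0) {P : Fin 3 → L}
    (hP : ∀ i, P i ^ (p ^ s) ^ (m + 1) = P i)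
    (hM : frobDet (p ^ s) P (fun c => (c : ℕ)) ≠ 0) {A B : MvPolynomial (Fin 3) L}
    (hAB : frobDet (p ^ s) MvPolynomial.X (gapExp 2 m) = A * B) :
    ¬ (MvPolynomial.eval P A = 0 ∧ MvPolynomial.eval P B = 0) := by
  have hq1 : 1 < p ^ s := Nat.one_lt_pow hs (Fact.out : p.Prime).one_lt
  set q := p ^ s with hq
  have hadd : ∀ (n : ℕ) (x y : L[X][X]), (x + y) ^ q ^ n = x ^ q ^ n + y ^ q ^ n :=
    fun n x y => add_pow_pow_char_pow p s n x y
  set N := q ^ (m + 2) with hN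
  have hN3 : q + 1 < N := by
    have h1 : q ^ 3 ≤ N := Nat.pow_le_pow_right (by omega) (by omega)
    have h2 : q ^ 3 = q * q * q := by ring
    have h3 : 2 * 2 * q ≤ q * q * q := Nat.mul_le_mul_right _ (Nat.mul_le_mul hq1 hq1)
    omega
  -- The q-th root of P, since P is fixed by the power q^(m+1). The vectors a, P, c are independent,
  -- so x = P + Y a + Z c, with Y = `C X` and Z = `X`, gives local parameters at P.
  let a : Fin 3 → L := fun i => P i ^ q ^ m
  let c : Fin 3 → L := fun i => P i ^ q
  let d : Fin 3 → L := fun i => P i ^ q ^ 2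
  have haq : ∀ i, a i ^ q = P i := fun i => by
    simp only [a]; rw [← pow_mul, ← pow_succ, hP]
  have hcq : ∀ i, c i ^ q = d i := fun i => by
    simp only [c, d]; rw [← pow_mul, sq]
  have hbN : ∀ i, P i ^ N = c i := fun i => by
    rw [hN, show m + 2 = (m + 1) + 1 by ring, pow_succ, pow_mul, hP]
  have haN : ∀ i, a i ^ N = P i := fun i => by
    rw [hN, show m + 2 = 1 + (m + 1) by ring, pow_add, pow_one, pow_mul, haq, hP]
  have hcN : ∀ i, c i ^ N = d i := fun i => by
    calc c i ^ N = (P i ^ N) ^ q := by simp only [c]; rw [← pow_mul, ← pow_mul, mul_comm]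
      _ = d i := by rw [hbN, hcq]
  have hC : ∀ (y : L) (n : ℕ), (C (C y) : L[X][X]) ^ n = C (C (y ^ n)) := by simp
  set x : Fin 3 → L[X][X] := fun i => C (C (P i)) + C X * C (C (a i)) + X * C (C (c i)) with hx
  have hx1 : ∀ i, x i ^ q = C (C (c i)) + C X ^ q * C (C (P i)) + X ^ q * C (C (d i)) := by
    intro i
    have := hadd 1
    simp only [pow_one] at this
    rw [hx]
    simp only
    rw [this, this, mul_pow, mul_pow, hC, hC, hC, haq, hcq]
  have hxN : ∀ i, x i ^ N = C (C (c i)) + C X ^ N * C (C (P i)) + X ^ N * C (C (d i)) := by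
    intro i
    rw [hx]
    simp only
    rw [hN, hadd, hadd, mul_pow, mul_pow, ← hN, hC, hC, hC, haN, hcN, hbN]
  have hcc : ∀ u v w : Fin 3 → L, det3 (fun i => (C (C (u i)) : L[X][X])) (fun i => C (C (v i)))
      (fun i => C (C (w i))) = C (C (det3 u v w)) := fun u v w =>
    (map_det3 ((C : L[X] →+* L[X][X]).comp (C : L →+* L[X])) u v w).symm
  have hg0 : gapExp 2 m 0 = 0 := gapExp_of_lt (by simp)
  have hg1 : gapExp 2 m 1 = 1 := gapExp_of_lt (by simp)
  have hg2 : gapExp 2 m 2 = m + 2 := (gapExp_last 2 m).trans (add_comm _ _)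
  obtain ⟨U, V, hUV⟩ : ∃ U V : L[X][X], frobDet q x (gapExp 2 m) =
      C (X ^ N) * U + X ^ N * V + X ^ q * C (C (det3 P d c) + X * C (det3 a d c)) +
        C (X ^ (q + 1) * C (det3 a P c)) := by
    refine ⟨det3 x (fun i => x i ^ q) (fun i => C (C (P i))),
      det3 x (fun i => x i ^ q) (fun i => C (C (d i))), ?_⟩
    rw [frobDet_eq_det3, hg0, hg1, hg2]
    simp only [pow_zero, pow_one, ← hN, hx1, hxN]
    refine (det3_expand (fun i => (C (C (a i)) : L[X][X])) (fun i => C (C (P i)))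
      (fun i => C (C (c i))) (fun i => C (C (d i))) (C X) X (C X ^ q) (X ^ q) (C X ^ N)
      (X ^ N)).trans ?_
    rw [hcc, hcc, hcc]
    simp only [C_mul, C_add, C_pow]
    ring
  have hφ : C (X ^ N) * U + X ^ N * V + X ^ q * C (C (det3 P d c) + X * C (det3 a d c)) +
        C (X ^ (q + 1) * C (det3 a P c)) =
      MvPolynomial.aeval x A * MvPolynomial.aeval x B := by
    rw [← hUV, ← map_mul, ← hAB, map_aeval_frobDet]
  have hD : det3 P d c ≠ 0 := by
    have h : det3 P d c = - frobDet q P (fun c => (c : ℕ)) := by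
      rw [frobDet_eq_det3]
      simp [det3, d]
      ring
    rw [h]
    exact neg_ne_zero.mpr hM
  have hD' : det3 a P c ≠ 0 := by
    intro h0
    have h1 : det3 a P c ^ q = frobDet q P (fun c => (c : ℕ)) := by
      have h2 := map_det3 (iterateFrobenius L p s) a P c
      simp only [iterateFrobenius_def, ← hq, haq, hcq] at h2
      rw [h2, frobDet_eq_det3]
      simp [d]
    rw [h0, zero_pow (by omega)] at h1
    exact hM h1.symm
  have hcoeff : ∀ i, i < N → (MvPolynomial.aeval x A * MvPolynomial.aeval x B).coeff i =
      X ^ N * U.coeff i + (if i = q then C (det3 P d c) + X * C (det3 a d c) else 0) +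
        (if i = 0 then X ^ (q + 1) * C (det3 a P c) else 0) := by
    intro i hi
    rw [← hφ, coeff_add, coeff_add, coeff_add, coeff_C_mul, coeff_X_pow_mul', if_neg (by omega),
      add_zero, coeff_C, mul_comm (X ^ q), coeff_C_mul_X_pow]
  rintro ⟨hA0, hB0⟩
  have hx0 : ∀ i, ((x i).coeff 0).coeff 0 = P i := by
    intro i
    rw [hx]
    simp
  -- The edge joins the terms Y^(q+1) det(a, P, c) and Z^q det(P, d, c).
  refine not_dvd_coeff_zero_of_newton_edge (π := (X : L[X])) prime_X (m := q + 1) (n := q)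
    (by omega) (by simp) (MvPolynomial.aeval x A) (MvPolynomial.aeval x B) ?_ ?_ ?_ ⟨?_, ?_⟩
  · rw [hcoeff q (by omega), if_pos rfl, if_neg (by omega), add_zero, X_dvd_iff]
    rw [coeff_add, coeff_X_pow_mul', if_neg (by omega), zero_add, coeff_add, coeff_C_zero,
      mul_coeff_zero, coeff_X_zero, zero_mul, add_zero]
    exact hD
  · rw [hcoeff 0 (by omega), if_pos rfl, if_neg (by omega), add_zero, X_pow_dvd_iff]
    intro h
    have := h (q + 1) (by omega)
    rw [coeff_add, coeff_X_pow_mul', if_neg (by omega), zero_add, coeff_X_pow_mul', if_pos le_rfl,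
      Nat.sub_self, coeff_C_zero] at this
    exact hD' this
  · intro i v hiv
    have hi : i < q := by
      by_contra! hi
      have := Nat.mul_le_mul_left (q + 1) hi
      have := Nat.zero_le (q * v)
      omega
    have hv : v < q + 1 := by
      by_contra! hv
      have := Nat.mul_le_mul_left q hv
      have := mul_comm q (q + 1)
      omega
    rw [hcoeff i (by omega), if_neg (by omega), add_zero]
    refine dvd_add ((pow_dvd_pow _ (by omega)).mul_right _) ?_
    split_ifs
    · exact (pow_dvd_pow _ (by omega)).mul_right _
    · exact dvd_zero _
  · rw [X_dvd_iff, coeff_zero_coeff_zero_aeval x P hx0, hA0]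
  · rw [X_dvd_iff, coeff_zero_coeff_zero_aeval x P hx0, hB0]

end

section

variable {L : Type*} [Field L] (p s : ℕ) [Fact p.Prime] [CharP L p]

open Polynomial in
/-- At a point over `𝔽_{q ^ (m + 1)}` on a hyperplane over `𝔽_q`, the cofactor of the Moore
determinant with exponents `0, 1, 2` has a single branch. -/
theorem not_eval_eq_zero_of_relation (hs : s ≠ 0) {m : ℕ} {P : Fin 3 → L}
    (hP : ∀ i, P i ^ (p ^ s) ^ (m + 1) = P i) {r : Fin 3} {b : Fin 2 → L}
    (hb : ∀ a, b a ^ p ^ s = b a) (hr : P r = ∑ a, b a * P (r.succAbove a))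
    (hP0 : ∃ a, P (r.succAbove a) ≠ 0) {A B : MvPolynomial (Fin 3) L}
    (hAB : frobDet (p ^ s) MvPolynomial.X (gapExp 2 m) =
      frobDet (p ^ s) MvPolynomial.X (fun c : Fin 3 => (c : ℕ)) * (A * B)) :
    ¬ (MvPolynomial.eval P A = 0 ∧ MvPolynomial.eval P B = 0) := by
  have hq1 : 1 < p ^ s := Nat.one_lt_pow hs (Fact.out : p.Prime).one_lt
  set q := p ^ s with hq
  set w : Fin 2 → L := fun a => P (r.succAbove a) with hw
  have hwN : ∀ a, w a ^ q ^ (m + 1) = w a := fun a => hP _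
  set N := q ^ (m + 1) with hN
  have hN1 : 1 < N := Nat.one_lt_pow (by omega) hq1
  -- Completing w by v makes w + Y v move along the given hyperplane, while Z, added in coordinate
  -- r, moves off it.
  obtain ⟨v, hv, hvN⟩ : ∃ v : Fin 2 → L, v 0 * w 1 - v 1 * w 0 = 1 ∧ ∀ a, v a ^ N = v a := by
    have hN0 : (0 : L) ^ N = 0 := zero_pow (by omega)
    have hneg : ∀ z : L, (-z) ^ N = -z ^ N := by
      intro z
      have h := add_pow_pow_char_pow p s (m + 1) z (-z)
      rw [add_neg_cancel, ← hq, ← hN, hN0] at h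
      exact eq_neg_of_add_eq_zero_right h.symm
    obtain ⟨a, ha⟩ := hP0
    by_cases h0 : w 0 = 0
    · have h1 : w 1 ≠ 0 := by
        intro h1
        fin_cases a
        · exact ha h0
        · exact ha h1
      exact ⟨![(w 1)⁻¹, 0], by simp [h1], by simp [Fin.forall_fin_two, hwN, hN0]⟩
    · exact ⟨![0, -(w 0)⁻¹], by simp [h0], by simp [Fin.forall_fin_two, hwN, hN0, hneg]⟩
  set y : Fin 2 → L[X] := fun a => C (w a) + X * C (v a) with hy
  have hyN : ∀ a, y a ^ N = C (w a) + X ^ N * C (v a) := by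
    intro a
    simp only [hy]
    rw [hN, add_pow_pow_char_pow, mul_pow, ← C_pow, ← C_pow, ← hN, hwN, hvN]
  set x : Fin 3 → L[X][X] :=
    r.insertNth (X + ∑ a, C (C (b a)) * C (y a)) (fun a => C (y a)) with hx
  let α : (Fin 3 → ℕ) → Fin 3 → L[X] := fun e c =>
    (-1) ^ (r + c : ℕ) * frobDet q y (fun j => e (c.succAbove j))
  have hxe : ∀ e : Fin 3 → ℕ, frobDet q x e = X * sparsePoly (α e) (fun c => q ^ e c - 1) := by
    intro e
    rw [X_mul_sparsePoly _ fun c => pow_pos (by omega) _, sparsePoly, hx, hq,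
      frobDet_insertNth p s r X _ (fun a => C (C (b a))) fun a => by rw [← C_pow, ← C_pow, hb]]
    refine Finset.sum_congr rfl fun c _ => ?_
    rw [← map_frobDet (C : L[X] →+* L[X][X])]
    simp only [α, C_mul, C_pow, C_neg, C_1]
    ring
  have hsub : ∀ z t : L[X], (z - t) ^ q = z ^ q - t ^ q := fun z t => sub_pow_char_pow ..
  clear_value q
  set SF := sparsePoly (α (gapExp 2 m)) (fun c => q ^ gapExp 2 m c - 1) with hSF
  set SM := sparsePoly (α fun c => (c : ℕ)) (fun c => q ^ (c : ℕ) - 1) with hSM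
  have hfac : SF = SM * MvPolynomial.aeval x A * MvPolynomial.aeval x B := by
    have h := congrArg (MvPolynomial.aeval x) hAB
    rw [map_aeval_frobDet, map_mul, map_mul, map_aeval_frobDet, hxe, hxe] at h
    refine mul_left_cancel₀ (X_ne_zero (R := L[X])) ?_
    rw [h]
    ring
  have hinj : ∀ e : Fin 3 → ℕ, StrictMono e → Function.Injective fun c => q ^ e c - 1 := by
    intro e he c c' h
    have h1 : 0 < q ^ e c := pow_pos (by omega) _
    have h2 : 0 < q ^ e c' := pow_pos (by omega) _
    have h3 : q ^ e c = q ^ e c' := by simp only at h; omega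
    exact he.injective (Nat.pow_right_injective hq1 h3)
  have hunit : ∀ n : ℕ, IsUnit ((-1 : L[X]) ^ n) := fun n => isUnit_one.neg.pow _
  have hg0 : gapExp 2 m 0 = 0 := gapExp_of_lt (by simp)
  have hg1 : gapExp 2 m 1 = 1 := gapExp_of_lt (by simp)
  have hg2 : gapExp 2 m 2 = m + 2 := (gapExp_last 2 m).trans (add_comm _ _)
  have hs00 : (0 : Fin 3).succAbove (0 : Fin 2) = 1 := rfl
  have hs01 : (0 : Fin 3).succAbove (1 : Fin 2) = 2 := rfl
  have hs10 : (1 : Fin 3).succAbove (0 : Fin 2) = 0 := rfl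
  have hs11 : (1 : Fin 3).succAbove (1 : Fin 2) = 2 := rfl
  have hSF0 : SF.coeff 0 = α (gapExp 2 m) 0 := by
    have := coeff_sparsePoly (α (gapExp 2 m)) (hinj _ (gapExp_strictMono 2 m)) 0
    simpa [hg0] using this
  have hSF1 : SF.coeff (q - 1) = α (gapExp 2 m) 1 := by
    have := coeff_sparsePoly (α (gapExp 2 m)) (hinj _ (gapExp_strictMono 2 m)) 1
    simpa [hg1] using this
  have hSM0 : SM.coeff 0 = α (fun c => (c : ℕ)) 0 := by
    have := coeff_sparsePoly (α fun c => (c : ℕ)) (hinj (fun c => (c : ℕ)) Fin.val_strictMono) 0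
    simpa using this
  have hSFi : ∀ i, 0 < i → i < q - 1 → SF.coeff i = 0 := by
    intro i hi hiq
    refine coeff_sparsePoly_of_ne _ fun c => ?_
    fin_cases c
    · simp [hg0]; omega
    · simp [hg1]; omega
    · have : q ≤ q ^ (m + 2) := Nat.le_self_pow (by omega) _
      simp [hg2]; omega
  have hα0 : α (gapExp 2 m) 0 = (-1) ^ (r + (0 : Fin 3) : ℕ) * (X ^ q * (1 - X ^ (N - 1)) ^ q) := by
    have h : y 0 * y 1 ^ N - y 0 ^ N * y 1 = X * (1 - X ^ (N - 1)) := by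
      have hvC : C (v 0) * C (w 1) - C (v 1) * C (w 0) = (1 : L[X]) := by
        rw [← C_mul, ← C_mul, ← C_sub, hv, C_1]
      have hX : (X : L[X]) ^ N = X * X ^ (N - 1) := (mul_pow_sub_one (by omega) _).symm
      rw [hyN, hyN]
      simp only [hy]
      rw [hX]
      linear_combination X * (1 - X ^ (N - 1)) * hvC
    simp only [α, frobDet_fin_two, hs00, hs01, hg1, hg2]
    rw [← mul_pow, ← h, hsub, mul_pow, mul_pow, ← pow_mul, ← pow_mul, hN, pow_one,
      show q ^ (m + 2) = q ^ (m + 1) * q by ring]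
  have hα1 : ((frobDet q y fun j => gapExp 2 m ((1 : Fin 3).succAbove j)).coeff 0) =
      w 0 * w 1 ^ q - w 0 ^ q * w 1 := by
    have hcy : ∀ a n, ((y a) ^ n).coeff 0 = w a ^ n := by
      intro a n
      rw [coeff_zero_eq_eval_zero]
      simp [hy]
    rw [frobDet_fin_two, coeff_sub, mul_coeff_zero, mul_coeff_zero, hcy, hcy, hcy, hcy, hs10, hs11,
      hg0, hg2, pow_zero, pow_one, pow_one, show q ^ (m + 2) = N * q by rw [hN]; ring, pow_mul,
      pow_mul, hwN, hwN]
  have hαM : α (fun c => (c : ℕ)) 0 =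
      (-1) ^ (r + (0 : Fin 3) : ℕ) * (y 0 * y 1 ^ q - y 0 ^ q * y 1) ^ q := by
    simp only [α, frobDet_fin_two, hs00, hs01]
    rw [hsub, mul_pow, mul_pow, ← pow_mul, ← pow_mul]
    simp [sq]
  have hstart : ¬ X ^ (q + 1) ∣ SF.coeff 0 := by
    rw [hSF0, hα0, (hunit _).dvd_mul_left, pow_succ]
    intro h
    have h1 := prime_X.dvd_of_dvd_pow ((mul_dvd_mul_iff_left (pow_ne_zero q X_ne_zero)).mp h)
    rw [X_dvd_iff] at h1
    simp [coeff_X_pow, show 0 ≠ N - 1 by omega] at h1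
  rintro ⟨hA0, hB0⟩
  have hx0 : ∀ i, ((x i).coeff 0).coeff 0 = P i := by
    intro i
    rw [hx]
    refine r.succAboveCases ?_ (fun a => ?_) i
    · simp [hr, hy, hw]
    · simp [hy, hw]
  have hXA : X ∣ (MvPolynomial.aeval x A).coeff 0 := by
    rw [X_dvd_iff, coeff_zero_coeff_zero_aeval x P hx0, hA0]
  have hXB : X ∣ (MvPolynomial.aeval x B).coeff 0 := by
    rw [X_dvd_iff, coeff_zero_coeff_zero_aeval x P hx0, hB0]
  -- When this vanishes, `SM` already contributes the factor Y^q to a coefficient not divisible by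
  -- Y^(q+1), so A cannot vanish at P. Otherwise there is an edge from (0, q) to (q - 1, 0).
  by_cases hw0 : w 0 * w 1 ^ q - w 0 ^ q * w 1 = 0
  · apply hstart
    rw [hfac, mul_coeff_zero, mul_coeff_zero, hSM0, hαM]
    refine Dvd.dvd.mul_right ?_ _
    rw [pow_succ]
    refine mul_dvd_mul (Dvd.dvd.mul_left (pow_dvd_pow_of_dvd ?_ _) _) hXA
    rw [X_dvd_iff, coeff_zero_eq_eval_zero]
    simpa [hy] using hw0
  · refine not_dvd_coeff_zero_of_newton_edge (π := (X : L[X])) prime_X (m := q) (n := q - 1)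
      (by omega) ?_ (SM * MvPolynomial.aeval x A) (MvPolynomial.aeval x B) ?_ ?_ ?_ ⟨?_, hXB⟩
    · exact (Nat.coprime_self_sub_left hq1.le).mpr (by simp)
    · rw [← hfac, hSF1, (hunit _).dvd_mul_left, X_dvd_iff, hα1]
      exact hw0
    · rwa [← hfac]
    · intro i v hiv
      rw [← hfac]
      have hi : i < q - 1 := by
        by_contra! hi
        have := Nat.mul_le_mul_left q hi
        omega
      rcases Nat.eq_zero_or_pos i with rfl | hi0
      · have hv : v < q := by
          by_contra! hv
          have := Nat.mul_le_mul_left (q - 1) hv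
          have := mul_comm q (q - 1)
          omega
        rw [hSF0, hα0]
        exact (((pow_dvd_pow X hv).mul_right _).mul_left _)
      · rw [hSFi i hi0 hi]
        exact dvd_zero _
    · rw [mul_coeff_zero]
      exact hXA.mul_left _

end

/-! ### Irreducibility in three variables, and assembly -/

namespace MvPolynomial

theorem isHomogeneous_frobDet_X {R : Type*} [CommRing R] (q : ℕ) {k : ℕ} (e : Fin k → ℕ) :
    (frobDet q (X : Fin k → MvPolynomial (Fin k) R) e).IsHomogeneous (∑ c, q ^ e c) := by
  rw [frobDet, Matrix.det_apply']
  refine IsHomogeneous.sum _ _ _ fun σ _ => ?_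
  have h : (∏ c, Matrix.of (fun r c => (X r : MvPolynomial (Fin k) R) ^ q ^ e c) (σ c) c).IsHomogeneous
      (∑ c, q ^ e c) :=
    IsHomogeneous.prod _ _ _ fun c _ => by simpa using (isHomogeneous_X R (σ c)).pow (q ^ e c)
  rw [show ((Equiv.Perm.sign σ : ℤ) : MvPolynomial (Fin k) R) = C ((Equiv.Perm.sign σ : ℤ) : R) by simp]
  exact h.C_mul _

theorem IsHomogeneous.isUnit_or_eval_zero {σ L : Type*} [Field L] {A : MvPolynomial σ L} {n : ℕ}
    (h : A.IsHomogeneous n) (hA : A ≠ 0) : IsUnit A ∨ eval 0 A = 0 := by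
  by_cases hn : n = 0
  · subst hn
    left
    have h0 := (totalDegree_eq_zero_iff_eq_C (p := A)).mp (by
      have := h.totalDegree_le; omega)
    rw [h0] at hA ⊢
    exact (isUnit_iff_ne_zero.mpr fun h1 => hA (by rw [h1, C_0])).map C
  · right
    rw [eval_zero]
    exact h.coeff_eq_zero (by simpa using Ne.symm hn)

theorem IsHomogeneous.eval_smul_eq {σ R : Type*} [CommRing R] {A : MvPolynomial σ R} {n : ℕ}
    (h : A.IsHomogeneous n) (c : R) (P : σ → R) : eval (c • P) A = c ^ n * eval P A := by
  rw [eval_eq, eval_eq, Finset.mul_sum]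
  refine Finset.sum_congr rfl fun d hd => ?_
  rw [h.degree_eq_sum_deg_support hd, ← Finset.prod_pow_eq_pow_sum]
  simp only [Pi.smul_apply, smul_eq_mul, mul_pow, Finset.prod_mul_distrib]
  ring

section

variable {L : Type*} [Field L] (p s : ℕ) [Fact p.Prime] [CharP L p]

/-- At a singular point, with a coordinate `1`, of the hypersurface with exponents `0, 1, m + 2`,
all coordinates belong to the field with `q ^ (m + 1)` elements. -/
theorem pow_eq_self_of_eval_pderiv_eq_zero (hs : s ≠ 0) {m : ℕ} {P : Fin 3 → L} {j : Fin 3}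
    (hj : P j = 1) (h : ∀ r, eval P (pderiv r (frobDet (p ^ s) X (gapExp 2 m))) = 0) (i : Fin 3) :
    P i ^ (p ^ s) ^ (m + 1) = P i := by
  by_cases hij : i = j
  · rw [hij, hj, one_pow]
  have hq : ((p ^ s : ℕ) : L) = 0 := by simp [hs]
  obtain ⟨r, hr⟩ : ∃ r : Fin 3, (r.succAbove 0 = i ∧ r.succAbove 1 = j) ∨
      (r.succAbove 0 = j ∧ r.succAbove 1 = i) := by
    clear hj h
    revert i j
    decide
  have hg1 : gapExp 2 m (Fin.succ 0) = 1 := gapExp_of_lt (by simp)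
  have hg2 : gapExp 2 m (Fin.succ 1) = (m + 1) + 1 := (gapExp_last 2 m).trans (by ring)
  have h1 := h r
  rw [pderiv_frobDet L hq (gapExp_strictMono 2 m) (gapExp_zero 1 m), map_mul, map_frobDet,
    frobDet_fin_two] at h1
  simp only [map_pow, map_neg, map_one, eval_X, hg1, hg2, pow_succ _ (m + 1), pow_one, pow_mul,
    mul_eq_zero, pow_eq_zero_iff', neg_eq_zero, one_ne_zero, false_and, false_or] at h1
  refine iterateFrobenius_inj L p s ?_
  simp only [iterateFrobenius_def]
  rcases hr with ⟨h0, h2⟩ | ⟨h0, h2⟩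
  · rw [h0, h2, hj] at h1
    simp only [one_pow, mul_one] at h1
    exact (sub_eq_zero.mp h1).symm
  · rw [h0, h2, hj] at h1
    simp only [one_pow, one_mul] at h1
    exact sub_eq_zero.mp h1

/-- The cofactor of the Moore determinant with exponents `0, 1, 2` in the one with exponents
`0, 1, m + 2` is irreducible. -/
theorem irreducible_of_frobDet_gapExp_two_eq_mul [IsAlgClosed L] (hs : s ≠ 0) {m : ℕ} (hm : m ≠ 0)
    {H : MvPolynomial (Fin 3) L} (hH : frobDet (p ^ s) X (gapExp 2 m) =
      frobDet (p ^ s) X (fun c : Fin 3 => (c : ℕ)) * H) : Irreducible H := by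
  have hq1 : 1 < p ^ s := Nat.one_lt_pow hs (Fact.out : p.Prime).one_lt
  have hF0 := frobDet_X_ne_zero L (p ^ s) hq1 (gapExp_strictMono 2 m)
  have hhom := isHomogeneous_frobDet_X (R := L) (p ^ s) (gapExp 2 m)
  have hmul : ∀ A B : MvPolynomial (Fin 3) L, frobDet (p ^ s) X (gapExp 2 m) = A * B →
      ∃ n, A.IsHomogeneous n := fun A B h => isHomogeneous_of_mul (h ▸ hhom) (h ▸ hF0)
  set M : MvPolynomial (Fin 3) L := frobDet (p ^ s) X (fun c : Fin 3 => (c : ℕ)) with hM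
  refine ⟨fun hu => ?_, fun A B hAB => ?_⟩
  · have hM0 : M ≠ 0 := frobDet_X_ne_zero L (p ^ s) hq1 Fin.val_strictMono
    have h := natDegree_finSuccEquiv_frobDet (L := L) hq1 (gapExp_strictMono 2 m)
    rw [hH, map_mul, Polynomial.natDegree_mul ((map_ne_zero_iff _ (finSuccEquiv L 2).injective).mpr hM0)
      ((map_ne_zero_iff _ (finSuccEquiv L 2).injective).mpr hu.ne_zero),
      Polynomial.natDegree_eq_zero_of_isUnit (hu.map (finSuccEquiv L 2)), hM,
      natDegree_finSuccEquiv_frobDet hq1 Fin.val_strictMono, gapExp_last] at h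
    have := Nat.pow_right_injective hq1 h
    simp at this
    exact hm this
  · rw [hAB] at hH
    obtain ⟨nA, hA⟩ := hmul A (M * B) (by rw [hH]; ring)
    obtain ⟨nB, hB⟩ := hmul B (M * A) (by rw [hH]; ring)
    have hMAB : M * (A * B) ≠ 0 := hH ▸ hF0
    have hA0 : A ≠ 0 := left_ne_zero_of_mul (right_ne_zero_of_mul hMAB)
    have hB0 : B ≠ 0 := right_ne_zero_of_mul (right_ne_zero_of_mul hMAB)
    by_contra! hu
    obtain ⟨P', hP', hPA', hPB'⟩ := exists_common_zero A B
      ((hA.isUnit_or_eval_zero hA0).resolve_left hu.1) ((hB.isUnit_or_eval_zero hB0).resolve_left hu.2)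
    obtain ⟨j, hj'⟩ := Function.ne_iff.mp hP'
    obtain ⟨P, hj, hPA, hPB⟩ : ∃ P : Fin 3 → L, P j = 1 ∧ eval P A = 0 ∧ eval P B = 0 := by
      refine ⟨(P' j)⁻¹ • P', by simpa using inv_mul_cancel₀ hj', ?_, ?_⟩
      · rw [hA.eval_smul_eq]; simp [hPA']
      · rw [hB.eval_smul_eq]; simp [hPB']
    -- A common zero of two factors is a singular point, by the Leibniz rule.
    have hPN := pow_eq_self_of_eval_pderiv_eq_zero p s hs hj (m := m) fun r => by
      rw [hH, (pderiv r).leibniz, (pderiv r).leibniz]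
      simp [hPA, hPB]
    by_cases hMP : frobDet (p ^ s) P (fun c => (c : ℕ)) = 0
    · obtain ⟨r, b, hb, hr⟩ := exists_relation_of_frobDet_eq_zero p s hj hMP
      refine not_eval_eq_zero_of_relation p s hs hPN hb hr ?_ hH ⟨hPA, hPB⟩
      by_contra! h0
      have : P j = 0 := by
        refine r.succAboveCases ?_ (fun a => h0 a) j
        rw [hr]
        simp [h0]
      rw [hj] at this
      exact one_ne_zero this
    · exact not_eval_eq_zero_of_frobDet_ne_zero p s hs hm hPN hMP
        (hH.trans (mul_assoc M A B).symm) ⟨by simp [hPA], hPB⟩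

theorem hasStableFactor_gapExp_two [IsAlgClosed L] {φ : L ≃+* L} (hs : s ≠ 0) {m : ℕ}
    (hm : m ≠ 0) : HasStableFactor φ (frobDet (p ^ s) X (fun c : Fin 3 => (c : ℕ)))
      (frobDet (p ^ s) X (gapExp 2 m)) := by
  have hq1 : 1 < p ^ s := Nat.one_lt_pow hs (Fact.out : p.Prime).one_lt
  have hq : ((p ^ s : ℕ) : L) = 0 := by simp [hs]
  obtain ⟨H, hH⟩ := frobDet_dvd p s (X : Fin 3 → MvPolynomial (Fin 3) L) (gapExp 2 m)
  have hirr := irreducible_of_frobDet_gapExp_two_eq_mul p s hs hm hH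
  refine ⟨H, hirr, ⟨_, hH.trans (mul_comm _ _)⟩, fun h => ?_, ?_⟩
  · exact not_mul_self_dvd_frobDet L hq1 hq (gapExp_strictMono 2 m) (gapExp_zero 1 m) hirr
      (hH ▸ mul_dvd_mul_right h H)
  · have h := congrArg (map (φ : L →+* L)) hH
    rw [map_mul, map_frobDet_X, map_frobDet_X, hH] at h
    rw [← mul_left_cancel₀ (frobDet_X_ne_zero L (p ^ s) hq1 Fin.val_strictMono) h]

theorem hasStableFactor_gapExp [IsAlgClosed L] {φ : L ≃+* L} (hs : s ≠ 0) {m : ℕ} (hm : m ≠ 0)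
    (k : ℕ) : HasStableFactor φ (frobDet (p ^ s) X (fun c : Fin (k + 3) => (c : ℕ)))
      (frobDet (p ^ s) X (gapExp (k + 2) m)) := by
  induction k with
  | zero => exact hasStableFactor_gapExp_two p s hs hm
  | succ k ih => exact hasStableFactor_gapExp_succ p s hs ih

/-- If the exponents other than the largest one are `0, d, 2 * d, …`, and the largest one is a
multiple of `d` but not the next one, then there is a stable factor. -/
theorem hasStableFactor_of_dvd [IsAlgClosed L] {φ : L ≃+* L} (hs : s ≠ 0) {k : ℕ}
    {e : Fin (k + 3) → ℕ} (he : StrictMono e) {d : ℕ}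
    (hd : ∀ j : Fin (k + 2), e j.castSucc = j * d) (hE : d ∣ e (Fin.last _))
    (hne : e (Fin.last _) ≠ (k + 2) * d) :
    HasStableFactor φ (frobDet (p ^ s) X (fun c : Fin (k + 3) => (c : ℕ))) (frobDet (p ^ s) X e) := by
  obtain ⟨t, ht⟩ := hE
  have hd0 : d ≠ 0 := by
    rintro rfl
    have h1 := he (show (0 : Fin (k + 2)).castSucc < (1 : Fin (k + 2)).castSucc by simp)
    rw [hd, hd] at h1
    simp at h1
  have hlast := he (Fin.castSucc_lt_last (Fin.last (k + 1)))
  rw [hd, ht, Fin.val_last, mul_comm] at hlast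
  have ht1 : k + 1 < t := lt_of_mul_lt_mul_left hlast (Nat.zero_le _)
  have ht2 : t ≠ k + 2 := by
    rintro rfl
    exact hne (ht.trans (mul_comm _ _))
  obtain ⟨m, rfl⟩ : ∃ m, t = k + 2 + (m + 1) := ⟨t - (k + 3), by omega⟩
  have heq : e = fun c => d * gapExp (k + 2) (m + 1) c := by
    funext c
    refine Fin.lastCases ?_ (fun j => ?_) c
    · rw [ht, gapExp_last]
    · rw [hd, gapExp_of_lt (Fin.castSucc_lt_last j), mul_comm]; rfl
  rw [heq, frobDet_mul_left, ← pow_mul]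
  obtain ⟨A, hA, hAF, hAM, hAφ⟩ := hasStableFactor_gapExp (L := L) p (s * d) (φ := φ)
    (mul_ne_zero hs hd0) (Nat.succ_ne_zero m) k
  -- Avoiding the determinant G for q^d is stronger than avoiding G for q, because the latter
  -- divides the former.
  refine ⟨A, hA, hAF, fun h => hAM (h.trans ?_), hAφ⟩
  rw [pow_mul, ← frobDet_mul_left (p ^ s) d]
  exact frobDet_dvd p s _ _

/-- Exponents are removed from the top until the rest is a progression. Since 0, d, 2d is one, the
case of three variables is vacuous. -/
theorem hasStableFactor_frobDet [IsAlgClosed L] {φ : L ≃+* L} (hs : s ≠ 0) {k : ℕ}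
    {e : Fin (k + 3) → ℕ} (he : StrictMono e) (he0 : e 0 = 0) (he2 : e 2 = 2 * e 1)
    (hAP : ¬ IsArithmeticProgression e) :
    HasStableFactor φ (frobDet (p ^ s) X (fun c : Fin (k + 3) => (c : ℕ))) (frobDet (p ^ s) X e) := by
  have hq1 : 1 < p ^ s := Nat.one_lt_pow hs (Fact.out : p.Prime).one_lt
  have hq : ((p ^ s : ℕ) : L) = 0 := by simp [hs]
  induction k with
  | zero =>
    refine absurd ⟨0, e 1, fun j => ?_⟩ hAP
    fin_cases j <;> simp [he0, he2]
  | succ k ih =>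
    by_cases h : IsArithmeticProgression fun j : Fin (k + 3) => e j.castSucc
    · obtain ⟨a, d, had⟩ := h
      obtain rfl : a = 0 := by simpa [he0] using (had 0).symm
      have hd : ∀ j : Fin (k + 3), e j.castSucc = j * d := by simpa using had
      by_cases hE : d ∣ e (Fin.last _)
      · refine hasStableFactor_of_dvd p s hs he hd hE fun hne => hAP ⟨0, d, fun j => ?_⟩
        refine Fin.lastCases ?_ (fun j => ?_) j
        · rw [hne]; simp
        · rw [hd]; simp
      · exact hasStableFactor_of_not_dvd hq1 hq he hd hE
    · exact hasStableFactor_frobDet_succ hq1 hq he he0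
        (ih (he.comp Fin.strictMono_castSucc) he0 he2 h)

end

end MvPolynomial

theorem corollary4p5 (q n k : ℕ) (hq : IsPrimePow q)
    (K : Type u) [Field K] (hK : Nat.card K = q ^ n)
    (hk : 3 ≤ k) (i : Fin k → ℕ) (hi : StrictMono i)
    (hi0 : i ⟨0, by omega⟩ = 0)
    (hi2 : i ⟨2, by omega⟩ = 2 * i ⟨1, by omega⟩)
    (hAP : ¬ IsArithmeticProgression i)
    (hcase : 7 ≤ q ∨ ((q = 3 ∨ q = 4 ∨ q = 5) ∧ 1 < i ⟨1, by omega⟩) ∨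
      (q = 2 ∧ 2 < i ⟨1, by omega⟩)) :
    ∃ H : MvPolynomial (Fin k) K, IsMooreQuotient K q i H ∧
      ∃ W : MvPolynomial (Fin k) K, IsNonrepeatedRationalAbsIrredComponent W H := by
  obtain ⟨p, s, hp, hs, rfl⟩ := hq
  have : Fact p.Prime := ⟨hp.nat_prime⟩
  have hq1 : 1 < p ^ s := Nat.one_lt_pow hs.ne' (Fact.out : p.Prime).one_lt
  have : Finite K := Nat.finite_of_card_ne_zero (by rw [hK]; exact pow_ne_zero _ (by omega))
  have : Fintype K := Fintype.ofFinite K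
  have : CharP K p := charP_of_card_eq_prime_pow (f := s * n) (by
    rw [← Nat.card_eq_fintype_card, hK, pow_mul])
  have hqK : ((p ^ s : ℕ) : K) = 0 := by simp [hs.ne']
  have : CharP (AlgebraicClosure K) p := charP_of_injective_algebraMap
    (algebraMap K (AlgebraicClosure K)).injective p
  obtain ⟨k, rfl⟩ : ∃ m, k = m + 3 := ⟨k - 3, by omega⟩
  have hG := MvPolynomial.frobDet_X_ne_zero K (p ^ s) hq1 (Fin.val_strictMono (n := k + 3))
  obtain ⟨H, hH⟩ := frobDet_dvd p s (MvPolynomial.X : Fin (k + 3) → MvPolynomial _ K) i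
  refine ⟨H, ⟨hG, hH⟩, ?_⟩
  obtain ⟨A, hA, hAF, hAG, hAφ⟩ := MvPolynomial.hasStableFactor_frobDet (L := AlgebraicClosure K) p s
    (φ := (FiniteField.frobeniusAlgEquivOfAlgebraic K (AlgebraicClosure K)).toRingEquiv)
    hs.ne' hi hi0 hi2 hAP
  obtain ⟨W, hW⟩ := MvPolynomial.exists_map_associated_of_frobenius_stable hA.ne_zero hAφ
  have hWirr := hW.symm.irreducible hA
  have hWK := MvPolynomial.irreducible_of_irreducible_map
    (algebraMap K (AlgebraicClosure K)) hWirr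
  have hmap : ∀ e : Fin (k + 3) → ℕ, MvPolynomial.map (algebraMap K (AlgebraicClosure K))
      (frobDet (p ^ s) MvPolynomial.X e) = frobDet (p ^ s) MvPolynomial.X e := by
    intro e
    rw [map_frobDet]
    simp
  have hAH : A ∣ MvPolynomial.map (algebraMap K (AlgebraicClosure K)) H := by
    rw [← hmap, hH, map_mul, hmap] at hAF
    exact (hA.prime.dvd_or_dvd hAF).resolve_left hAG
  refine ⟨W, isAbsolutelyIrreducible_of_algebraicClosure hWirr,
    MvPolynomial.map_dvd_map_iff_of_field hWK.ne_zero (hW.dvd.trans hAH), fun h => ?_⟩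
  -- A square dividing F/G would divide F, which is squarefree over K as well.
  rw [sq] at h
  exact MvPolynomial.not_mul_self_dvd_frobDet K hq1 hqK hi hi0 hWK
    (h.trans (hH ▸ dvd_mul_left _ _))
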